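/- Let $0<h<1$, let $\lambda:=\lfloor 2/h\rfloor+1$, and let $L$ be an even integer with $L\ge 2\lambda$. Let $\Lambda=(\mathbb Z/L\mathbb Z)^2$ be the two-dimensional torus and $\mathcal S=\{-1,+1\}^{\Lambda}$. For $\sigma\in\mathcal S$ and $x\in\Lambda$ let $S_\sigma(x)$ be the sum of $\sigma(y)$ over the four nearest neighbours $y$ of $x$. For $\beta>0$ consider the probabilistic cellular automaton on $\mathcal S$ with transition probabilities $$p(\sigma,\eta)=\prod_{x\in\Lambda}\frac{1}{1+\exp\{-2\beta\,\eta(x)(S_\sigma(x)+h)\}},$$ which is reversible with respect to $e^{-\beta H}$, where $H(\sigma)=-h\sum_{x}\sigma(x)-\frac1\beta\sum_{x}\log\cosh[\beta(S_\sigma(x)+h)]$. Its zero-temperature energy and energy cost are $$E(\sigma)=\lim_{\beta\to\infty}H(\sigma)=-h\sum_{x\in\Lambda}\sigma(x)-\sum_{x\in\Lambda}|S_\sigma(x)+h|,$$ $$\Delta(\sigma,\eta)=-\lim_{\beta\to\infty}\frac{\log p(\sigma,\eta)}{\beta}=\sum_{x:\,\eta(x)(S_\sigma(x)+h)<0}2|S_\sigma(x)+h|,$$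 and the communication height is $E(\sigma,\eta)=E(\sigma)+\Delta(\sigma,\eta)$. A path is a finite sequence $\omega=(\omega_1,\dots,\omega_n)$, $n\ge1$, in $\mathcal S$; its height is $\Phi_\omega=E(\omega_1)$ if $n=1$ and $\Phi_\omega=\max_{1\le i<n}E(\omega_i,\omega_{i+1})$ otherwise. For $A\subset\mathcal S$ let $\Phi(\sigma,A)$ be the minimum of $\Phi_\omega$ over all paths from $\sigma$ to an element of $A$ ($+\infty$ if $A=\emptyset$). Let $\mathcal I_\sigma=\{\eta: E(\eta)<E(\sigma)\}$, let $V_\sigma=\Phi(\sigma,\mathcal I_\sigma)-E(\sigma)$ be the stability level of $\sigma$, let $X^{\mathrm s}$ be the set of global minima of $E$ (the ground states), let $\Gamma=\max_{\sigma\in\mathcal S\setminus X^{\mathrm s}}V_\sigma$ be the communication energy, and let $X^{\mathrm m}=\{\eta\in\mathcal S: V_\eta=\Gamma\}$ be the set of metastable states. Let $\mathbf u\equiv+1$, $\mathbf d\equiv-1$, and let $\mathbf c^{\mathrm e}(x)=(-1)^{x_1+x_2}$, $\mathbf c^{\mathrm o}(x)=(-1)^{x_1+x_2+1}$ be the two checkerboards.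 Then $$X^{\mathrm s}=\{\mathbf u\},\qquad X^{\mathrm m}=\{\mathbf d,\mathbf c^{\mathrm e},\mathbf c^{\mathrm o}\},\qquad E(\mathbf d)>E(\mathbf c^{\mathrm e})=E(\mathbf c^{\mathrm o}),$$ and $\Gamma>0$ with $$\Gamma=\Gamma_{\mathrm m}:=-2h\lambda^2+2(4+h)\lambda-2h .$$ -/

import Mathlib

namespace PCA

/-- The two-dimensional torus of side `L`. -/
abbrev Site (L : ℕ) : Type := ZMod L × ZMod L

/-- Spin configurations; `ℤˣ` is the set `{-1, +1}`. -/
abbrev Config (L : ℕ) : Type := Site L → ℤˣ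

/-- The spin `σ(x) ∈ {-1, +1}` as a real number. -/
def spin {L : ℕ} (σ : Config L) (x : Site L) : ℝ := ((σ x : ℤ) : ℝ)

/-- The nearest-neighbour kernel: `K z = 1` if `z` is at distance one from the origin of the
torus, and `K z = 0` otherwise. -/
def K {L : ℕ} (z : Site L) : ℝ :=
  if z = (1, 0) ∨ z = (-1, 0) ∨ z = (0, 1) ∨ z = (0, -1) then 1 else 0

noncomputable section

/-! ### The chain at inverse temperature `β` and field `h` -/

/-- `S_σ(x) = ∑_y K(x - y) σ(y)`. -/
def S {L : ℕ} [NeZero L] (σ : Config L) (x : Site L) : ℝ :=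
  ∑ y : Site L, K (x - y) * spin σ y

/-- The one-site updating rule `p_{x,σ}(s)`. -/
def siteProb {L : ℕ} [NeZero L] (β h : ℝ) (x : Site L) (σ : Config L) (s : ℤˣ) : ℝ :=
  1 / (1 + Real.exp (-2 * β * ((s : ℤ) : ℝ) * (S σ x + h)))

/-- The transition matrix `p(σ, η)` of the PCA. -/
def transProb {L : ℕ} [NeZero L] (β h : ℝ) (σ η : Config L) : ℝ :=
  ∏ x : Site L, siteProb β h x σ (η x)

/-- The Hamiltonian `H(σ)`, with respect to which the PCA is reversible. -/
def hamiltonian {L : ℕ} [NeZero L] (β h : ℝ) (σ : Config L) : ℝ :=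
  -h * ∑ x : Site L, spin σ x
    - 1 / β * ∑ x : Site L, Real.log (Real.cosh (β * (S σ x + h)))

/-! ### The zero-temperature energy landscape -/

/-- The energy `E(σ)`, the limit of `H(σ)` as `β → ∞` (see `tendsto_hamiltonian`). -/
def energy {L : ℕ} [NeZero L] (h : ℝ) (σ : Config L) : ℝ :=
  -h * ∑ x : Site L, spin σ x - ∑ x : Site L, |S σ x + h|

/-- The energy cost `Δ(σ, η)`, the limit of `-(log p(σ, η)) / β` as `β → ∞`
(see `tendsto_transProb`). -/
def cost {L : ℕ} [NeZero L] (h : ℝ) (σ η : Config L) : ℝ :=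
  ∑ x : Site L with spin η x * (S σ x + h) < 0, 2 * |S σ x + h|

/-- The communication height `E(σ, η) = E(σ) + Δ(σ, η)`, the limit of
`H(σ, η) = H(σ) - (log p(σ, η)) / β` as `β → ∞`. -/
def commHeight {L : ℕ} [NeZero L] (h : ℝ) (σ η : Config L) : ℝ :=
  energy h σ + cost h σ η

/-- The height `Φ_ω` along a path `ω = (ω 0, …, ω n)`. -/
def height {L : ℕ} [NeZero L] (h : ℝ) : (n : ℕ) → (Fin (n + 1) → Config L) → ℝ
  | 0, ω => energy h (ω 0)
  | n + 1, ω => Finset.univ.sup' ⟨(0 : Fin (n + 1)), Finset.mem_univ _⟩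
      (fun i : Fin (n + 1) => commHeight h (ω i.castSucc) (ω i.succ))

/-- The minimax `Φ(σ, η)`: the least height of a path from `σ` to `η`. -/
def minimax {L : ℕ} [NeZero L] (h : ℝ) (σ η : Config L) : EReal :=
  ⨅ (n : ℕ) (ω : Fin (n + 1) → Config L) (_ : ω 0 = σ) (_ : ω (Fin.last n) = η),
    ((height h n ω : ℝ) : EReal)

/-- `Φ(σ, A)`: the least height of a path from `σ` to the set `A` (`⊤` if `A` is empty). -/
def minimaxSet {L : ℕ} [NeZero L] (h : ℝ) (σ : Config L) (A : Set (Config L)) : EReal :=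
  ⨅ η ∈ A, minimax h σ η

/-- `I_σ`: the configurations with energy strictly below that of `σ`. -/
def lowerSet {L : ℕ} [NeZero L] (h : ℝ) (σ : Config L) : Set (Config L) :=
  {η | energy h η < energy h σ}

/-- The stability level `V_σ = Φ(σ, I_σ) - E(σ)`; it is `⊤` when `I_σ` is empty, that is,
when `σ` is a ground state. -/
def stabilityLevel {L : ℕ} [NeZero L] (h : ℝ) (σ : Config L) : EReal :=
  minimaxSet h σ (lowerSet h σ) - ((energy h σ : ℝ) : EReal)

/-- `X^s`: the ground states, i.e. the global minima of the energy. -/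
def groundStates (L : ℕ) [NeZero L] (h : ℝ) : Set (Config L) :=
  {σ | ∀ η : Config L, energy h σ ≤ energy h η}

/-- The communication energy `Γ = max_{σ ∉ X^s} V_σ`. -/
def commEnergy (L : ℕ) [NeZero L] (h : ℝ) : EReal :=
  ⨆ σ ∈ (groundStates L h)ᶜ, stabilityLevel h σ

/-- `X^m`: the metastable states, those with `V_η = Γ`. -/
def metastableStates (L : ℕ) [NeZero L] (h : ℝ) : Set (Config L) :=
  {η | stabilityLevel h η = commEnergy L h}

/-! ### The special configurations and the activation energy -/

/-- The configuration `u`: all spins plus. -/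
def allPlus (L : ℕ) : Config L := fun _ => 1

/-- The configuration `d`: all spins minus. -/
def allMinus (L : ℕ) : Config L := fun _ => -1

/-- The checkerboard `c^e` with pluses on the even sublattice, `c^e(x) = (-1)^(x₁ + x₂)`. -/
def checkerEven (L : ℕ) : Config L := fun x => (-1) ^ (x.1.val + x.2.val)

/-- The checkerboard `c^o` with pluses on the odd sublattice, `c^o(x) = (-1)^(x₁ + x₂ + 1)`. -/
def checkerOdd (L : ℕ) : Config L := fun x => (-1) ^ (x.1.val + x.2.val + 1)

/-- The critical length `λ = ⌊2/h⌋ + 1`. -/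
def critLength (h : ℝ) : ℕ := ⌊2 / h⌋₊ + 1

/-- The activation energy `Γ_m = -2hλ² + 2(4 + h)λ - 2h`. -/
def activationEnergy (h : ℝ) : ℝ :=
  -2 * h * (critLength h : ℝ) ^ 2 + 2 * (4 + h) * (critLength h : ℝ) - 2 * h

/-! ### `energy` and `cost` are the zero-temperature limits -/

open Filter Topology in
theorem tendsto_log_cosh (a : ℝ) :
    Tendsto (fun β : ℝ => 1 / β * Real.log (Real.cosh (β * a))) atTop (𝓝 |a|) := by
  have h0 : Tendsto (fun β : ℝ => |a| - Real.log 2 * β⁻¹) atTop (𝓝 |a|) := by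
    simpa using (tendsto_const_nhds (x := |a|)).sub
      ((tendsto_inv_atTop_zero (𝕜 := ℝ)).const_mul (Real.log 2))
  refine tendsto_of_tendsto_of_tendsto_of_le_of_le' h0 tendsto_const_nhds ?_ ?_
  all_goals
    filter_upwards [eventually_gt_atTop (0 : ℝ)] with β hβ
    have hc : Real.cosh (β * a) = (Real.exp (β * |a|) + Real.exp (-(β * |a|))) / 2 := by
      rw [← Real.cosh_eq, ← Real.cosh_abs (β * a), abs_mul, abs_of_pos hβ]
    have hp : 0 ≤ β * |a| := by positivity
  · have : β * |a| - Real.log 2 ≤ Real.log (Real.cosh (β * a)) := by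
      rw [Real.le_log_iff_exp_le (Real.cosh_pos _), Real.exp_sub, Real.exp_log two_pos, hc]
      have := Real.exp_pos (-(β * |a|))
      linarith
    calc |a| - Real.log 2 * β⁻¹ = 1 / β * (β * |a| - Real.log 2) := by field_simp
      _ ≤ _ := by gcongr
  · have : Real.log (Real.cosh (β * a)) ≤ β * |a| := by
      rw [Real.log_le_iff_le_exp (Real.cosh_pos _), hc]
      have := Real.exp_le_exp.2 (by linarith : -(β * |a|) ≤ β * |a|)
      linarith
    calc _ ≤ 1 / β * (β * |a|) := by gcongr
      _ = |a| := by field_simp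

open Filter Topology in
theorem tendsto_hamiltonian {L : ℕ} [NeZero L] (h : ℝ) (σ : Config L) :
    Tendsto (fun β : ℝ => hamiltonian β h σ) atTop (𝓝 (energy h σ)) := by
  unfold hamiltonian energy
  refine tendsto_const_nhds.sub ?_
  simp only [Finset.mul_sum]
  exact tendsto_finsetSum _ fun x _ => tendsto_log_cosh _

open Filter Topology in
theorem tendsto_transProb {L : ℕ} [NeZero L] (h : ℝ) (σ η : Config L) :
    Tendsto (fun β : ℝ => -(Real.log (transProb β h σ η) / β)) atTop (𝓝 (cost h σ η)) := by
  have key : ∀ b : ℝ, Tendsto (fun β : ℝ => -(Real.log (1 / (1 + Real.exp (-2 * β * b))) / β))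
      atTop (𝓝 (if b < 0 then 2 * |b| else 0)) := by
    intro b
    have e : (if b < 0 then 2 * |b| else 0) = -b + |b| := by
      split_ifs with hb
      · rw [abs_of_neg hb]; ring
      · rw [abs_of_nonneg (not_lt.1 hb)]; ring
    rw [e]
    have h0 : Tendsto (fun β : ℝ => Real.log 2 * β⁻¹ + (-b + 1 / β * Real.log (Real.cosh (β * b))))
        atTop (𝓝 (-b + |b|)) := by
      simpa using ((tendsto_inv_atTop_zero (𝕜 := ℝ)).const_mul (Real.log 2)).add
        ((tendsto_log_cosh b).const_add (-b))
    refine h0.congr' ?_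
    filter_upwards [eventually_gt_atTop (0 : ℝ)] with β hβ
    have : 1 + Real.exp (-2 * β * b) = 2 * Real.exp (-(β * b)) * Real.cosh (β * b) := by
      rw [Real.cosh_eq]
      have h1 : Real.exp (-(β * b)) * Real.exp (β * b) = 1 := by
        rw [← Real.exp_add]; simp
      have h2 : Real.exp (-2 * β * b) = Real.exp (-(β * b)) * Real.exp (-(β * b)) := by
        rw [← Real.exp_add]; ring_nf
      rw [h2]; linear_combination -h1
    rw [one_div (1 + _), Real.log_inv, this, Real.log_mul (by positivity) (Real.cosh_pos _).ne',
      Real.log_mul two_ne_zero (Real.exp_pos _).ne', Real.log_exp]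
    field_simp
    ring
  have habs : ∀ x, |spin η x| = 1 := by
    intro x
    rcases Int.units_eq_one_or (η x) with hx | hx <;> simp [spin, hx]
  have hsum : ∀ β : ℝ, -(Real.log (transProb β h σ η) / β) = ∑ x : Site L,
      -(Real.log (1 / (1 + Real.exp (-2 * β * (spin η x * (S σ x + h))))) / β) := by
    intro β
    unfold transProb siteProb
    rw [Real.log_prod (fun x _ => by positivity), Finset.sum_div, ← Finset.sum_neg_distrib]
    simp only [spin, mul_assoc]
  simp only [hsum]
  unfold cost
  rw [Finset.sum_filter]
  refine tendsto_finsetSum _ fun x _ => ?_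
  have := key (spin η x * (S σ x + h))
  rwa [abs_mul, habs, one_mul] at this

end

end PCA

/-!
On a torus of even side the nearest neighbours of a site have the other parity. So `S σ` on one
sublattice depends only on the spins of `σ` on the other one, and for the configuration `mix p σ η`,
made of the spins of `σ` on the sublattice of parity `p` and of those of `η` on the other
sublattice, the communication height satisfies
`E(σ, η) = isingEnergy (mix 0 σ η) + isingEnergy (mix 1 σ η)`, where `isingEnergy` is the ordinary
nearest-neighbour Ising energy. The minimum over `η` is attained by the majority rule, and thus
`E(σ)` is the sum of two half energies, each being the Ising energy of the spins of `σ` on one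
sublattice completed in the best possible way.

Lower bound: by isoperimetry on the torus a configuration with exactly `λ(λ - 1) + 1` pluses has
Ising energy at least `Γ_m` above that of all minuses. Two configurations that agree on one
sublattice can be joined by single flips without exceeding the larger of their energies, since on
the other sublattice the spins do not interact. So no step of height below the barrier takes a half
from fewer pluses than that number to at least as many.

Upper bound: the join of `s` with a growing droplet has small energy, because submodularity gives
`isingEnergy (s ⊔ t) - isingEnergy s ≤ isingEnergy t - isingEnergy (s ⊓ t)`. A droplet that grows
through squares costs at most `Γ_m`, so a half that is all minus can be left at this cost. If a half
has a plus next to a minus of its completion, the droplet started there meets `s`, which saves the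
cost `8 - 2h` of a single plus. Hence only configurations with two constant halves can have
stability level `Γ_m`.
-/

namespace PCA

noncomputable section

open Finset Function

/-! ### Spins, neighbours and sublattices -/

section Sublattices

variable {L : ℕ} {h : ℝ} {p : ZMod 2} {σ η s t : Config L} {x y : Site L}

lemma abs_spin (σ : Config L) (x : Site L) : |spin σ x| = 1 := by
  rcases Int.units_eq_one_or (σ x) with hx | hx <;> simp [spin, hx]

@[simp] lemma spin_allPlus (x : Site L) : spin (allPlus L) x = 1 := by simp [spin, allPlus]

@[simp] lemma spin_allMinus (x : Site L) : spin (allMinus L) x = -1 := by simp [spin, allMinus]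

lemma K_nonneg (z : Site L) : 0 ≤ K z := by
  unfold K
  split_ifs <;> norm_num

lemma K_neg (z : Site L) : K (-z) = K z := by
  unfold K
  congr 1
  simp only [neg_eq_iff_eq_neg, Prod.neg_mk, neg_neg, neg_zero, eq_iff_iff]
  tauto

lemma K_sub_comm (x y : Site L) : K (x - y) = K (y - x) := by
  rw [← K_neg, neg_sub]

/-- The class of `x₁ + x₂` modulo two. It is additive only on a torus of even side. -/
def parity (x : Site L) : ZMod 2 := x.1.cast + x.2.cast

/-- The even (`p = 0`) or odd (`p = 1`) sublattice; in general `p + 1` is the other sublattice. -/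
def sublattice (L : ℕ) (p : ZMod 2) : Set (Site L) := {x | parity x = p}

lemma ne_iff_eq_add_one {a b : ZMod 2} : a ≠ b ↔ a = b + 1 := by
  revert a b
  decide

lemma parity_add (L_even : Even L) (x y : Site L) : parity (x + y) = parity x + parity y := by
  simp only [parity, Prod.fst_add, Prod.snd_add, ZMod.cast_add L_even.two_dvd]
  ring

lemma parity_neg (L_even : Even L) (x : Site L) : parity (-x) = parity x := by
  simp only [parity, Prod.fst_neg, Prod.snd_neg, ZMod.cast_neg L_even.two_dvd, CharTwo.neg_eq]

lemma parity_of_K_ne_zero (L_even : Even L) {z : Site L} (hz : K z ≠ 0) : parity z = 1 := by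
  have h₁ : parity ((1, 0) : Site L) = 1 := by simp [parity, ZMod.cast_one L_even.two_dvd]
  have h₂ : parity ((0, 1) : Site L) = 1 := by simp [parity, ZMod.cast_one L_even.two_dvd]
  rcases (ite_ne_right_iff.1 hz).1 with rfl | rfl | rfl | rfl
  · exact h₁
  · simpa [h₁] using parity_neg L_even ((1, 0) : Site L)
  · exact h₂
  · simpa [h₂] using parity_neg L_even ((0, 1) : Site L)

lemma parity_eq_add_one_of_K_sub_ne_zero (L_even : Even L) (hxy : K (x - y) ≠ 0) :
    parity x = parity y + 1 := by
  rw [← parity_of_K_ne_zero L_even hxy, ← parity_add L_even, add_sub_cancel]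

/-- The configuration equal to `σ` on the sublattice of parity `p` and to `η` on the other one. -/
def mix (p : ZMod 2) (σ η : Config L) : Config L :=
  fun x => if parity x = p then σ x else η x

lemma mix_eqOn_left (p : ZMod 2) (σ η : Config L) : Set.EqOn (mix p σ η) σ (sublattice L p) :=
  fun _ hx => if_pos hx

lemma mix_eqOn_right (p : ZMod 2) (σ η : Config L) :
    Set.EqOn (mix p σ η) η (sublattice L (p + 1)) :=
  fun _ hx => if_neg (ne_iff_eq_add_one.2 hx)

lemma eq_mix (hσ : Set.EqOn s σ (sublattice L p)) (hη : Set.EqOn s η (sublattice L (p + 1))) :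
    s = mix p σ η := by
  ext1 x
  by_cases hx : parity x = p
  · rw [mix_eqOn_left p σ η hx, hσ hx]
  · rw [mix_eqOn_right p σ η (ne_iff_eq_add_one.1 hx), hη (ne_iff_eq_add_one.1 hx)]

lemma mix_self (p : ZMod 2) (σ : Config L) : mix p σ σ = σ :=
  (eq_mix (fun _ _ => rfl) fun _ _ => rfl).symm

lemma mix_add_one (p : ZMod 2) (σ η : Config L) : mix (p + 1) σ η = mix p η σ := by
  refine eq_mix (fun x hx => mix_eqOn_right (p + 1) σ η ?_) (mix_eqOn_left (p + 1) σ η)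
  rwa [CharTwo.add_cancel_right]

variable [NeZero L]

lemma sum_sublattice_add (p : ZMod 2) (f : Site L → ℝ) :
    ∑ x with parity x = p, f x + ∑ x with parity x = p + 1, f x = ∑ x, f x := by
  simp only [← ne_iff_eq_add_one, sum_filter_add_sum_filter_not]

lemma S_eq_of_eqOn (L_even : Even L) (hση : Set.EqOn σ η (sublattice L (parity x + 1))) :
    S σ x = S η x := by
  refine sum_congr rfl fun y _ => ?_
  by_cases hK : K (x - y) = 0
  · simp only [hK, zero_mul]
  · have hy : parity y = parity x + 1 :=
      parity_eq_add_one_of_K_sub_ne_zero L_even (K_sub_comm x y ▸ hK)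
    rw [spin, spin, hση hy]

lemma S_eq_neighbors (L_gt : 2 < L) (σ : Config L) (x : Site L) :
    S σ x = spin σ (x + (1, 0)) + spin σ (x - (1, 0)) + spin σ (x + (0, 1))
      + spin σ (x - (0, 1)) := by
  have : Fact (2 < L) := ⟨L_gt⟩
  have : Fact (1 < L) := ⟨by lia⟩
  have one_ne : (1 : ZMod L) ≠ -1 := ZMod.neg_one_ne_one.symm
  have neg_one_ne : (-1 : ZMod L) ≠ 0 := neg_ne_zero.2 one_ne_zero
  have hK (z : Site L) : K z = (if z = (1, 0) then 1 else 0) + (if z = -(1, 0) then 1 else 0)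
      + (if z = (0, 1) then 1 else 0) + (if z = -(0, 1) then 1 else (0 : ℝ)) := by
    obtain ⟨a, b⟩ := z
    simp only [K, Prod.neg_mk, neg_zero, Prod.mk.injEq]
    grind [one_ne_zero (α := ZMod L)]
  rw [S, ← (Equiv.subLeft x).sum_comp]
  simp only [Equiv.subLeft_apply, sub_sub_cancel, hK, add_mul, sum_add_distrib, ite_mul,
    one_mul, zero_mul, sum_ite_eq', mem_univ, if_true, sub_neg_eq_add]
  ring

lemma S_allMinus (L_gt : 2 < L) (x : Site L) : S (allMinus L) x = -4 := by
  norm_num [S_eq_neighbors L_gt]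

/-! ### The Ising energy -/

/-- The nearest-neighbour Ising energy with coupling one and field `h`, to which the energy
landscape of the automaton is reduced. The factor `1 / 2` makes every bond count once. -/
def isingEnergy (h : ℝ) (s : Config L) : ℝ :=
  -h * ∑ x, spin s x - 1 / 2 * ∑ x, spin s x * S s x

lemma sum_spin_mul_S_sublattice (L_even : Even L) (p : ZMod 2) (s : Config L) :
    ∑ x with parity x = p, spin s x * S s x = ∑ x with parity x = p + 1, spin s x * S s x := by
  simp only [S, mul_sum, sum_filter, ite_sum_zero]
  rw [sum_comm]
  refine sum_congr rfl fun x _ => sum_congr rfl fun y _ => ?_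
  by_cases hK : K (x - y) = 0
  · simp only [K_sub_comm y x, hK, zero_mul, mul_zero, ite_self]
  · have h_term : spin s y * (K (y - x) * spin s x) = spin s x * (K (x - y) * spin s y) := by
      rw [K_sub_comm]
      ring
    simp only [parity_eq_add_one_of_K_sub_ne_zero L_even hK, add_left_inj, h_term]

lemma isingEnergy_eq_sum_sublattice (L_even : Even L) (h : ℝ) (p : ZMod 2) (s : Config L) :
    isingEnergy h s = -h * ∑ x with parity x = p, spin s x
      - ∑ x with parity x = p + 1, spin s x * (S s x + h) := by
  simp only [mul_add, sum_add_distrib, ← sum_mul]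
  rw [isingEnergy, ← sum_sublattice_add p, ← sum_sublattice_add p (fun x => spin s x * S s x),
    sum_spin_mul_S_sublattice L_even p]
  ring

lemma isingEnergy_mix (L_even : Even L) (h : ℝ) (p : ZMod 2) (σ η : Config L) :
    isingEnergy h (mix p σ η) = -h * ∑ x with parity x = p, spin σ x
      - ∑ x with parity x = p + 1, spin η x * (S σ x + h) := by
  have h_spin : ∀ x ∈ univ.filter (parity · = p), spin (mix p σ η) x = spin σ x := fun x hx =>
    congrArg (fun u : ℤˣ => ((u : ℤ) : ℝ)) (mix_eqOn_left p σ η (mem_filter.1 hx).2)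
  have h_term : ∀ x ∈ univ.filter (parity · = p + 1),
      spin (mix p σ η) x * (S (mix p σ η) x + h) = spin η x * (S σ x + h) := fun x hx => by
    have hx : parity x = p + 1 := (mem_filter.1 hx).2
    have hS : S (mix p σ η) x = S σ x := S_eq_of_eqOn L_even <| by
      simpa only [hx, CharTwo.add_cancel_right] using mix_eqOn_left p σ η
    rw [hS, spin, mix_eqOn_right p σ η hx, spin]
  rw [isingEnergy_eq_sum_sublattice L_even h p, sum_congr rfl h_spin, sum_congr rfl h_term]

lemma isingEnergy_flip (L_even : Even L) (h : ℝ) (s : Config L) (x : Site L) :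
    isingEnergy h (Function.update s x (-s x)) = isingEnergy h s + 2 * spin s x * (S s x + h) := by
  set s' := Function.update s x (-s x) with hs'
  have s'_of_ne {y : Site L} (hy : y ≠ x) : spin s' y = spin s y := by
    rw [spin, hs', Function.update_of_ne hy, spin]
  have ne_x {y : Site L} (hy : parity y = parity x + 1) : y ≠ x := fun hyx =>
    ne_iff_eq_add_one.2 hy (hyx ▸ rfl)
  have h_mix : s' = mix (parity x + 1) s s' :=
    eq_mix (fun y hy => Function.update_of_ne (ne_x hy) _ _) fun _ _ => rfl
  have h_sum : ∑ y with parity y = parity x + 1 + 1, spin s' y * (S s y + h)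
      - ∑ y with parity y = parity x + 1 + 1, spin s y * (S s y + h)
      = -2 * spin s x * (S s x + h) := by
    rw [← sum_sub_distrib, sum_eq_single_of_mem x (by simp [CharTwo.add_cancel_right])
      fun y _ hy => by rw [s'_of_ne hy, sub_self]]
    simp [spin, hs']
    ring
  rw [h_mix, isingEnergy_mix L_even, isingEnergy_eq_sum_sublattice L_even h (parity x + 1) s]
  linarith

/-- Submodularity, which holds because the interaction is ferromagnetic. -/
lemma isingEnergy_sup_add_isingEnergy_inf_le (h : ℝ) (s t : Config L) :
    isingEnergy h (s ⊔ t) + isingEnergy h (s ⊓ t) ≤ isingEnergy h s + isingEnergy h t := by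
  have h_units (a b c d : ℤˣ) : ((a ⊔ b : ℤˣ) + (a ⊓ b : ℤˣ) : ℤ) = a + b ∧
      (a * c + b * d : ℤ) ≤ (a ⊔ b : ℤˣ) * (c ⊔ d : ℤˣ) + (a ⊓ b : ℤˣ) * (c ⊓ d : ℤˣ) := by
    revert a b c d
    decide
  have h_field (x : Site L) : spin (s ⊔ t) x + spin (s ⊓ t) x = spin s x + spin t x := by
    unfold spin
    exact_mod_cast (h_units (s x) (t x) 1 1).1
  have h_bond (x y : Site L) : spin s x * spin s y + spin t x * spin t y ≤
      spin (s ⊔ t) x * spin (s ⊔ t) y + spin (s ⊓ t) x * spin (s ⊓ t) y := by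
    unfold spin
    exact_mod_cast (h_units (s x) (t x) (s y) (t y)).2
  have h_fields : ∑ x, spin (s ⊔ t) x + ∑ x, spin (s ⊓ t) x = ∑ x, spin s x + ∑ x, spin t x := by
    simp only [← sum_add_distrib, h_field]
  have h_bonds : ∑ x, spin s x * S s x + ∑ x, spin t x * S t x
      ≤ ∑ x, spin (s ⊔ t) x * S (s ⊔ t) x + ∑ x, spin (s ⊓ t) x * S (s ⊓ t) x := by
    simp only [S, mul_sum, ← sum_add_distrib]
    refine sum_le_sum fun x _ => sum_le_sum fun y _ => ?_
    linarith [mul_le_mul_of_nonneg_left (h_bond x y) (K_nonneg (x - y))]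
  unfold isingEnergy
  linear_combination 1 / 2 * h_bonds - h * h_fields

lemma isingEnergy_allPlus_add_le (h : ℝ) (s : Config L) :
    isingEnergy h (allPlus L) + h * ∑ x, (1 - spin s x) ≤ isingEnergy h s := by
  have h_bonds : ∑ x, spin s x * S s x ≤ ∑ x, spin (allPlus L) x * S (allPlus L) x := by
    simp only [S, mul_sum]
    refine sum_le_sum fun x _ => sum_le_sum fun y _ => ?_
    have h_bond : spin s x * spin s y ≤ 1 :=
      (le_abs_self _).trans_eq (by rw [abs_mul, abs_spin, abs_spin, one_mul])
    simp only [spin_allPlus]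
    linarith [mul_le_mul_of_nonneg_left h_bond (K_nonneg (x - y))]
  simp only [isingEnergy, sum_sub_distrib, spin_allPlus] at h_bonds ⊢
  linarith

lemma sum_one_sub_spin_nonneg (s : Config L) : 0 ≤ ∑ x, (1 - spin s x) :=
  sum_nonneg fun x _ => sub_nonneg.2 ((le_abs_self _).trans_eq (abs_spin s x))

lemma isingEnergy_allPlus_le (h_nonneg : 0 ≤ h) (s : Config L) :
    isingEnergy h (allPlus L) ≤ isingEnergy h s :=
  (le_add_of_nonneg_right (mul_nonneg h_nonneg (sum_one_sub_spin_nonneg s))).trans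
    (isingEnergy_allPlus_add_le h s)

lemma isingEnergy_allPlus_lt (h_pos : 0 < h) (hs : s ≠ allPlus L) :
    isingEnergy h (allPlus L) < isingEnergy h s := by
  obtain ⟨x, hx⟩ := Function.ne_iff.1 hs
  have hx : s x = -1 := (Int.units_eq_one_or (s x)).resolve_left hx
  have h_sum : 0 < ∑ y, (1 - spin s y) :=
    sum_pos' (fun y _ => sub_nonneg.2 ((le_abs_self _).trans_eq (abs_spin s y)))
      ⟨x, mem_univ x, by norm_num [spin, hx]⟩
  exact (lt_add_of_pos_right _ (mul_pos h_pos h_sum)).trans_le (isingEnergy_allPlus_add_le h s)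

/-! ### Reduction of the energy landscape to the Ising energy -/

/-- The zero-temperature update of `σ`, in which every site aligns with its local field; a
vanishing local field is resolved in favour of `+1`. -/
def majority (h : ℝ) (σ : Config L) : Config L :=
  fun x => if 0 ≤ S σ x + h then 1 else -1

lemma spin_majority_mul (h : ℝ) (σ : Config L) (x : Site L) :
    spin (majority h σ) x * (S σ x + h) = |S σ x + h| := by
  unfold spin majority
  split_ifs with hx
  · simp [abs_of_nonneg hx]
  · simp [abs_of_neg (not_le.1 hx)]

/-- The Ising energy of the restriction of `σ` to the sublattice of parity `p`, completed by the
zero-temperature update on the other sublattice. The energy of `σ` is the sum of its two half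
energies. -/
def halfEnergy (h : ℝ) (p : ZMod 2) (σ : Config L) : ℝ :=
  isingEnergy h (mix p σ (majority h σ))

lemma halfEnergy_le_isingEnergy_mix (L_even : Even L) (h : ℝ) (p : ZMod 2) (σ η : Config L) :
    halfEnergy h p σ ≤ isingEnergy h (mix p σ η) := by
  rw [halfEnergy, isingEnergy_mix L_even, isingEnergy_mix L_even]
  refine sub_le_sub_left (sum_le_sum fun x _ => ?_) _
  rw [spin_majority_mul, ← one_mul |_|, ← abs_spin η x, ← abs_mul]
  exact le_abs_self _

lemma halfEnergy_le_isingEnergy (L_even : Even L) (h : ℝ) (hσ : Set.EqOn s σ (sublattice L p)) :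
    halfEnergy h p σ ≤ isingEnergy h s := by
  rw [eq_mix hσ fun _ _ => rfl]
  exact halfEnergy_le_isingEnergy_mix L_even h p σ s

lemma isingEnergy_mix_add_isingEnergy_mix (L_even : Even L) (h : ℝ) (p : ZMod 2)
    (σ η : Config L) :
    isingEnergy h (mix p σ η) + isingEnergy h (mix (p + 1) σ η)
      = -h * ∑ x, spin σ x - ∑ x, spin η x * (S σ x + h) := by
  rw [isingEnergy_mix L_even, isingEnergy_mix L_even, CharTwo.add_cancel_right,
    ← sum_sublattice_add p (spin σ), ← sum_sublattice_add p]
  ring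

lemma energy_eq_halfEnergy_add (L_even : Even L) (h : ℝ) (p : ZMod 2) (σ : Config L) :
    energy h σ = halfEnergy h p σ + halfEnergy h (p + 1) σ := by
  simp only [halfEnergy, isingEnergy_mix_add_isingEnergy_mix L_even, spin_majority_mul, energy]

lemma commHeight_eq_isingEnergy_add (L_even : Even L) (h : ℝ) (p : ZMod 2)
    (σ η : Config L) :
    commHeight h σ η = isingEnergy h (mix p σ η) + isingEnergy h (mix (p + 1) σ η) := by
  have h_site (x : Site L) : (if spin η x * (S σ x + h) < 0 then 2 * |S σ x + h| else 0)
      = |S σ x + h| - spin η x * (S σ x + h) := by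
    rw [← one_mul |S σ x + h|, ← abs_spin η x, ← abs_mul]
    split_ifs with hx
    · rw [abs_of_neg hx]
      ring
    · rw [abs_of_nonneg (not_lt.1 hx), sub_self]
  rw [isingEnergy_mix_add_isingEnergy_mix L_even, commHeight, energy, cost, sum_filter,
    sum_congr rfl fun x _ => h_site x, sum_sub_distrib]
  ring

end Sublattices

/-! ### The critical length -/

section Isoperimetry

variable {L : ℕ} {h : ℝ}

lemma two_lt_mul_critLength (h_pos : 0 < h) : 2 < h * critLength h := by
  have h_floor := Nat.lt_floor_add_one (2 / h)
  rw [div_lt_iff₀' h_pos] at h_floor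
  exact_mod_cast h_floor

lemma one_lt_critLength (h_pos : 0 < h) (h_le : h ≤ 2) : 1 < critLength h := by
  have h_two : 2 < 2 * (critLength h : ℝ) :=
    (two_lt_mul_critLength h_pos).trans_le (by gcongr)
  exact_mod_cast lt_of_mul_lt_mul_left (by linarith : (2 : ℝ) * 1 < 2 * critLength h) two_pos.le

lemma mul_critLength_sub_one_le (h_pos : 0 < h) : h * ((critLength h : ℝ) - 1) ≤ 2 := by
  have h_floor := Nat.floor_le (a := 2 / h) (by positivity)
  rw [le_div_iff₀' h_pos] at h_floor
  simpa [critLength] using h_floor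

lemma sq_mul_critLength_mul_le (h_pos : 0 < h) :
    h ^ 2 * (critLength h * ((critLength h : ℝ) - 1)) ≤ 8 := by
  have h_upper := mul_critLength_sub_one_le h_pos
  have h_ge : 1 ≤ critLength h := Nat.le_add_left ..
  rcases h_ge.eq_or_lt with h_one | h_two
  · rw [← h_one]
    norm_num
  have h_two : (2 : ℝ) ≤ critLength h := by exact_mod_cast h_two
  have h_double : (critLength h : ℝ) ≤ 2 * (critLength h - 1) := by linarith
  calc h ^ 2 * (critLength h * ((critLength h : ℝ) - 1))
      ≤ h ^ 2 * (2 * (critLength h - 1) * ((critLength h : ℝ) - 1)) := by gcongr; linarith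
    _ = 2 * (h * ((critLength h : ℝ) - 1)) ^ 2 := by ring
    _ ≤ 2 * 2 ^ 2 := by gcongr; exact mul_nonneg h_pos.le (by linarith)
    _ = 8 := by norm_num

lemma four_lt_mul_side (h_pos : 0 < h) (L_large : 2 * critLength h ≤ L) : 4 < h * L := by
  have h_side : (2 * critLength h : ℝ) ≤ L := by exact_mod_cast L_large
  nlinarith [two_lt_mul_critLength h_pos]

/-- The number of pluses of a critical droplet: a rectangle of sides `λ` and `λ - 1` with one
additional site attached. -/
def critCount (h : ℝ) : ℕ := critLength h * (critLength h - 1) + 1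

lemma critCount_cast (h : ℝ) :
    (critCount h : ℝ) = critLength h * ((critLength h : ℝ) - 1) + 1 := by
  simp [critCount, critLength]

lemma activationEnergy_eq (h : ℝ) :
    activationEnergy h = 8 * critLength h - 2 * h * critCount h := by
  rw [critCount_cast, activationEnergy]
  ring

lemma two_mul_le_add_of_mul_pred_lt_mul {l a b : ℕ} (hab : l * (l - 1) < a * b) :
    2 * l ≤ a + b := by
  by_contra! h_lt
  obtain ⟨m, rfl⟩ := Nat.exists_eq_succ_of_ne_zero (show l ≠ 0 by lia)
  rw [Nat.succ_sub_one] at hab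
  nlinarith [four_mul_le_sq_add a b, Nat.pow_le_pow_left (show a + b ≤ 2 * m + 1 by lia) 2]

/-! ### Isoperimetry on the torus -/

variable [NeZero L] {s : Config L}

lemma exists_and_not_add_one {P : ZMod L → Prop} {i j : ZMod L} (hi : P i) (hj : ¬P j) :
    ∃ k, P k ∧ ¬P (k + 1) := by
  by_contra! h_step
  have h_all (n : ℕ) : P (i + n) := by
    induction n with
    | zero => simpa using hi
    | succ n ih => simpa [add_assoc] using h_step _ ih
  exact hj (by simpa [ZMod.natCast_zmod_val] using h_all (j - i).val)

lemma one_sub_mul_nonneg (a b : ℤˣ) : (0 : ℝ) ≤ 1 - (a : ℤ) * (b : ℤ) := by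
  rcases Int.units_eq_one_or a with rfl | rfl <;> rcases Int.units_eq_one_or b with rfl | rfl <;>
    norm_num

lemma four_le_sum_one_sub_mul_of_ne {f : ZMod L → ℤˣ} {i j : ZMod L} (hij : f i ≠ f j) :
    4 ≤ ∑ k, (1 - ((f k : ℤ) : ℝ) * (f (k + 1) : ℤ)) := by
  obtain ⟨k, hk, hk'⟩ := exists_and_not_add_one (P := fun k => f k = f i) rfl hij.symm
  obtain ⟨l, hl, hl'⟩ := exists_and_not_add_one (P := fun k => f k ≠ f i) hij.symm (not_not.2 rfl)
  have h_two {m : ZMod L} (hm : f m ≠ f (m + 1)) :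
      1 - ((f m : ℤ) : ℝ) * (f (m + 1) : ℤ) = 2 := by
    rw [Int.units_ne_iff_eq_neg.1 hm]
    rcases Int.units_eq_one_or (f (m + 1)) with h1 | h1 <;> norm_num [h1]
  calc (4 : ℝ) = ∑ m ∈ {k, l}, (1 - ((f m : ℤ) : ℝ) * (f (m + 1) : ℤ)) := by
        rw [sum_pair (by grind), h_two (by grind), h_two (by grind)]
        norm_num
    _ ≤ _ := sum_le_sum_of_subset_of_nonneg (subset_univ _) fun m _ _ => one_sub_mul_nonneg _ _

/-- The number of pluses of a configuration, that is, the area of its droplets. -/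
def plusCount (s : Config L) : ℕ := #{x | s x = 1}

/-- The horizontal lines on which `s` is not constant. Each contributes at least two bonds to the
boundary of the plus region, and so does each line of `mixedCols s`. -/
def mixedRows (s : Config L) : Finset (ZMod L) := {y | ∃ i j, s (i, y) ≠ s (j, y)}

/-- The vertical lines on which `s` is not constant. -/
def mixedCols (s : Config L) : Finset (ZMod L) := {x | ∃ i j, s (x, i) ≠ s (x, j)}

lemma mem_mixedRows {y : ZMod L} : y ∈ mixedRows s ↔ ∃ i j, s (i, y) ≠ s (j, y) := by
  simp [mixedRows]

lemma mem_mixedCols {x : ZMod L} : x ∈ mixedCols s ↔ ∃ i j, s (x, i) ≠ s (x, j) := by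
  simp [mixedCols]

lemma plusCount_allMinus : plusCount (allMinus L) = 0 :=
  card_eq_zero.2 (filter_eq_empty_iff.2 fun _ _ => by unfold allMinus; decide)

lemma sum_spin (s : Config L) : ∑ x, spin s x = 2 * plusCount s - (L : ℝ) ^ 2 := by
  have h_spin (x : Site L) : spin s x = 2 * (if s x = 1 then 1 else 0) - 1 := by
    rcases Int.units_eq_one_or (s x) with hx | hx <;> norm_num [spin, hx]
  simp only [h_spin, sum_sub_distrib, ← mul_sum, sum_boole, plusCount]
  simp [ZMod.card, sq]

lemma sum_spin_mul_S (L_gt : 2 < L) (s : Config L) :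
    ∑ x, spin s x * S s x = 2 * ∑ x : Site L, spin s x * spin s (x + (1, 0))
      + 2 * ∑ x : Site L, spin s x * spin s (x + (0, 1)) := by
  have h_shift (z : Site L) :
      ∑ x, spin s x * spin s (x - z) = ∑ x, spin s x * spin s (x + z) := by
    rw [← Equiv.sum_comp (Equiv.addRight z)]
    exact sum_congr rfl fun x _ => by simp [mul_comm]
  simp only [S_eq_neighbors L_gt, mul_add, sum_add_distrib, h_shift]
  ring

lemma isingEnergy_sub_isingEnergy_allMinus (L_gt : 2 < L) (h : ℝ) (s : Config L) :
    isingEnergy h s - isingEnergy h (allMinus L)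
      = ∑ x : Site L, (1 - spin s x * spin s (x + (1, 0)))
      + ∑ x : Site L, (1 - spin s x * spin s (x + (0, 1))) - 2 * h * plusCount s := by
  rw [isingEnergy, isingEnergy, sum_spin_mul_S L_gt, sum_spin_mul_S L_gt, sum_spin, sum_spin,
    plusCount_allMinus]
  simp only [spin_allMinus, sum_sub_distrib, Nat.cast_zero, neg_mul_neg, one_mul]
  ring

lemma four_mul_card_mixed_le (L_gt : 2 < L) (h : ℝ) (s : Config L) :
    4 * (#(mixedCols s) + #(mixedRows s) : ℝ) - 2 * h * plusCount s
      ≤ isingEnergy h s - isingEnergy h (allMinus L) := by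
  have h_lines {T : Finset (ZMod L)} {g : ZMod L → ℝ} (hg : ∀ y, 0 ≤ g y)
      (hT : ∀ y ∈ T, 4 ≤ g y) : 4 * (#T : ℝ) ≤ ∑ y, g y := by
    rw [mul_comm, ← nsmul_eq_mul]
    exact (card_nsmul_le_sum T g 4 hT).trans
      (sum_le_sum_of_subset_of_nonneg (subset_univ _) fun y _ _ => hg y)
  have h_rows : 4 * (#(mixedRows s) : ℝ) ≤ ∑ x : Site L, (1 - spin s x * spin s (x + (1, 0))) := by
    rw [Fintype.sum_prod_type_right]
    refine h_lines (fun y => sum_nonneg fun _ _ => one_sub_mul_nonneg _ _) fun y hy => ?_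
    obtain ⟨i, j, hij⟩ := mem_mixedRows.1 hy
    simpa [spin] using four_le_sum_one_sub_mul_of_ne (f := fun k => s (k, y)) hij
  have h_cols : 4 * (#(mixedCols s) : ℝ) ≤ ∑ x : Site L, (1 - spin s x * spin s (x + (0, 1))) := by
    rw [Fintype.sum_prod_type]
    refine h_lines (fun x => sum_nonneg fun _ _ => one_sub_mul_nonneg _ _) fun x hx => ?_
    obtain ⟨i, j, hij⟩ := mem_mixedCols.1 hx
    simpa [spin] using four_le_sum_one_sub_mul_of_ne (f := fun k => s (x, k)) hij
  rw [isingEnergy_sub_isingEnergy_allMinus L_gt]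
  linarith

lemma card_filter_eq_le_of_no_constant_line {a : ℤˣ} (h_row : ∀ y, ∃ i, s (i, y) ≠ a)
    (h_col : ∀ x, ∃ j, s (x, j) ≠ a) :
    #{x | s x = a} ≤ #(mixedCols s) * #(mixedRows s) := by
  rw [← card_product]
  refine card_le_card fun x hx => ?_
  have hx : s x = a := (mem_filter.1 hx).2
  obtain ⟨i, hi⟩ := h_row x.2
  obtain ⟨j, hj⟩ := h_col x.1
  exact mem_product.2 ⟨mem_mixedCols.2 ⟨j, x.2, hx ▸ hj⟩, mem_mixedRows.2 ⟨i, x.1, hx ▸ hi⟩⟩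

lemma plusCount_add_card_filter_eq_neg_one (s : Config L) :
    plusCount s + #{x | s x = -1} = L * L := by
  simp only [← Int.units_ne_iff_eq_neg]
  rw [plusCount, card_filter_add_card_filter_not, card_univ, Fintype.card_prod, ZMod.card]

/-- In the three cases the plus region has no full line, some full lines in one direction only, and
full lines in both directions. -/
lemma plusCount_le_or_le_card_mixed_or_le_plusCount_add (s : Config L) :
    plusCount s ≤ #(mixedCols s) * #(mixedRows s) ∨ L ≤ #(mixedCols s) + #(mixedRows s) ∨
      L * L ≤ plusCount s + #(mixedCols s) * #(mixedRows s) := by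
  by_cases h_row : ∀ y, ∃ i, s (i, y) ≠ 1 <;> by_cases h_col : ∀ x, ∃ j, s (x, j) ≠ 1
  · exact .inl (card_filter_eq_le_of_no_constant_line h_row h_col)
  · push Not at h_col
    obtain ⟨x, hx⟩ := h_col
    have h_univ : mixedRows s = univ := eq_univ_iff_forall.2 fun y =>
      mem_mixedRows.2 ((h_row y).imp fun i hi => ⟨x, by rwa [hx y]⟩)
    simp [h_univ, ZMod.card]
  · push Not at h_row
    obtain ⟨y, hy⟩ := h_row
    have h_univ : mixedCols s = univ := eq_univ_iff_forall.2 fun x =>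
      mem_mixedCols.2 ((h_col x).imp fun j hj => ⟨y, by rwa [hy x]⟩)
    simp [h_univ, ZMod.card]
  · push Not at h_row h_col
    obtain ⟨x, hx⟩ := h_col
    obtain ⟨y, hy⟩ := h_row
    rw [← plusCount_add_card_filter_eq_neg_one s]
    exact .inr <| .inr <| Nat.add_le_add_left (card_filter_eq_le_of_no_constant_line
      (fun z => ⟨x, by rw [hx z]; decide⟩) fun z => ⟨y, by rw [hy z]; decide⟩) _

lemma plusCount_le_or_two_mul_critLength_le (L_large : 2 * critLength h ≤ L)
    (hs : plusCount s ≤ critCount h) :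
    plusCount s ≤ #(mixedCols s) * #(mixedRows s) ∨
      2 * critLength h ≤ #(mixedCols s) + #(mixedRows s) := by
  rcases plusCount_le_or_le_card_mixed_or_le_plusCount_add s with h_none | h_one | h_both
  · exact .inl h_none
  · exact .inr (L_large.trans h_one)
  · have h_half : 2 * critCount h ≤ L * L := by
      refine le_trans ?_ (Nat.mul_le_mul L_large L_large)
      simp only [critCount, critLength, add_tsub_cancel_right]
      nlinarith
    exact .inl (by lia)

lemma activationEnergy_le_of_plusCount_eq (L_gt : 2 < L) (L_large : 2 * critLength h ≤ L)
    (hs : plusCount s = critCount h) :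
    isingEnergy h (allMinus L) + activationEnergy h ≤ isingEnergy h s := by
  have h_mixed : 2 * critLength h ≤ #(mixedCols s) + #(mixedRows s) := by
    refine (plusCount_le_or_two_mul_critLength_le L_large hs.le).elim (fun h_area => ?_) id
    refine two_mul_le_add_of_mul_pred_lt_mul (lt_of_lt_of_le ?_ h_area)
    exact hs ▸ Nat.lt_succ_self _
  have h_mixed : (2 * critLength h : ℝ) ≤ #(mixedCols s) + #(mixedRows s) := by
    exact_mod_cast h_mixed
  rw [activationEnergy_eq, ← hs]
  linarith [four_mul_card_mixed_le L_gt h s]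

lemma isingEnergy_allMinus_le (L_gt : 2 < L) (h_pos : 0 < h) (L_large : 2 * critLength h ≤ L)
    (hs : plusCount s < critCount h) : isingEnergy h (allMinus L) ≤ isingEnergy h s := by
  suffices h_area : h * plusCount s ≤ 2 * (#(mixedCols s) + #(mixedRows s)) by
    linarith [four_mul_card_mixed_le L_gt h s]
  have hA : (plusCount s : ℝ) ≤ critLength h * ((critLength h : ℝ) - 1) := by
    have : (plusCount s + 1 : ℝ) ≤ critCount h := by exact_mod_cast hs
    linarith [critCount_cast h]
  rcases plusCount_le_or_two_mul_critLength_le L_large hs.le with h_prod | h_sum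
  · have h_prod : (plusCount s : ℝ) ≤ #(mixedCols s) * #(mixedRows s) := by exact_mod_cast h_prod
    have h_sq_mul : h ^ 2 * plusCount s ≤ 8 :=
      (mul_le_mul_of_nonneg_left hA (sq_nonneg h)).trans (sq_mul_critLength_mul_le h_pos)
    refine (le_abs_self _).trans (abs_le_of_sq_le_sq ?_ (by positivity))
    calc (h * (plusCount s : ℝ)) ^ 2 = h ^ 2 * plusCount s * plusCount s := by ring
      _ ≤ 8 * (#(mixedCols s) * #(mixedRows s) : ℝ) := by gcongr
      _ ≤ (2 * (#(mixedCols s) + #(mixedRows s) : ℝ)) ^ 2 := by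
        nlinarith [sq_nonneg (#(mixedCols s) - #(mixedRows s) : ℝ)]
  · have h_sum : (2 * critLength h : ℝ) ≤ #(mixedCols s) + #(mixedRows s) := by
      exact_mod_cast h_sum
    nlinarith [(critLength h).cast_nonneg (α := ℝ), mul_critLength_sub_one_le h_pos]

end Isoperimetry

/-! ### The barrier between few and many pluses -/

section Barrier

section Update

variable {ι α : Type*} [DecidableEq ι] {f g : ι → α} {i : ι}

lemma hammingDist_update_lt [Fintype ι] [DecidableEq α] (hi : f i ≠ g i) :
    hammingDist (update f i (g i)) g < hammingDist f g := by
  refine card_lt_card ((ssubset_iff_of_subset fun j hj => ?_).2 ⟨i, by simpa, by simp⟩)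
  rcases eq_or_ne j i with rfl | hji
  · simp at hj
  · simpa [hji] using hj

lemma eqOn_update_left {A : Set ι} (hfg : Set.EqOn f g A) (i : ι) :
    Set.EqOn (update f i (g i)) g A := by
  intro j hj
  rcases eq_or_ne j i with rfl | hji
  · exact update_self ..
  · rw [update_of_ne hji, hfg hj]

end Update

variable {L : ℕ} [NeZero L] {h : ℝ} {p : ZMod 2} {σ η s t : Config L}

lemma plusCount_update_le (s : Config L) (x : Site L) (a : ℤˣ) :
    plusCount (update s x a) ≤ plusCount s + 1 := by
  refine (card_le_card fun y hy => ?_).trans (card_insert_le x {y | s y = 1})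
  rcases eq_or_ne y x with rfl | hyx
  · simp
  · simpa [hyx] using hy

lemma plusCount_le_update_add_one (s : Config L) (x : Site L) (a : ℤˣ) :
    plusCount s ≤ plusCount (update s x a) + 1 := by
  simpa using plusCount_update_le (update s x a) x (s x)

lemma exists_flip_isingEnergy_le (L_even : Even L) (h : ℝ)
    (hst : Set.EqOn s t (sublattice L p)) (hne : s ≠ t) :
    ∃ x, s x ≠ t x ∧ (isingEnergy h (update s x (t x)) ≤ isingEnergy h s ∨
      isingEnergy h (update t x (s x)) ≤ isingEnergy h t) := by
  obtain ⟨x, hx⟩ := ne_iff.1 hne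
  refine ⟨x, hx, ?_⟩
  have h_parity : parity x = p + 1 := ne_iff_eq_add_one.1 fun hp => hx (hst hp)
  have h_field : S s x = S t x := S_eq_of_eqOn L_even <| by
    rwa [h_parity, CharTwo.add_cancel_right]
  -- `s` and `t` feel the same field at `x`, so the two flips change the energy oppositely.
  have h_spin : spin s x = -spin t x := by simp [spin, Int.units_ne_iff_eq_neg.1 hx]
  rw [Int.units_ne_iff_eq_neg.1 hx.symm, isingEnergy_flip L_even,
    ← neg_neg (s x), ← Int.units_ne_iff_eq_neg.1 hx.symm, isingEnergy_flip L_even, h_field, h_spin]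
  rcases le_total 0 (spin t x * (S t x + h)) with h_nonneg | h_nonpos
  · exact Or.inl (by linarith)
  · exact Or.inr (by linarith)

lemma exists_plusCount_eq (L_even : Even L) {s t : Config L} {c : ℝ} {n : ℕ}
    (hst : Set.EqOn s t (sublattice L p)) (hs : plusCount s < n) (ht : n ≤ plusCount t)
    (hsc : isingEnergy h s < c) (htc : isingEnergy h t < c) :
    ∃ r : Config L, plusCount r = n ∧ isingEnergy h r < c := by
  have hne : s ≠ t := by rintro rfl; exact hs.not_ge ht
  obtain ⟨x, hx, hle | hle⟩ := exists_flip_isingEnergy_le L_even h hst hne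
  · by_cases hn : plusCount (update s x (t x)) < n
    · have := hammingDist_update_lt hx
      exact exists_plusCount_eq L_even (eqOn_update_left hst x) hn ht (hle.trans_lt hsc) htc
    · exact ⟨_, le_antisymm ((plusCount_update_le s x _).trans hs) (not_lt.1 hn),
        hle.trans_lt hsc⟩
  · by_cases hn : n ≤ plusCount (update t x (s x))
    · have : hammingDist s (update t x (s x)) < hammingDist s t := by
        simpa only [hammingDist_comm s] using hammingDist_update_lt hx.symm
      exact exists_plusCount_eq L_even (eqOn_update_left hst.symm x).symm hs hn hsc
        (hle.trans_lt htc)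
    · exact ⟨t, le_antisymm ((plusCount_le_update_add_one t x _).trans (not_le.1 hn)) ht, htc⟩
termination_by hammingDist s t

lemma plusCount_mix_lt (L_even : Even L) (L_gt : 2 < L) (L_large : 2 * critLength h ≤ L)
    {ξ : Config L} (hs : plusCount (mix p σ η) < critCount h)
    (hη : isingEnergy h (mix p σ η) < isingEnergy h (allMinus L) + activationEnergy h)
    (hξ : isingEnergy h (mix p σ ξ) < isingEnergy h (allMinus L) + activationEnergy h) :
    plusCount (mix p σ ξ) < critCount h := by
  by_contra! h_ge
  obtain ⟨r, hr, hr_lt⟩ := exists_plusCount_eq L_even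
    ((mix_eqOn_left p σ η).trans (mix_eqOn_left p σ ξ).symm) hs h_ge hη hξ
  exact (activationEnergy_le_of_plusCount_eq L_gt L_large hr).not_gt hr_lt

/-- The half of `σ` on the sublattice of parity `p`, completed by the zero-temperature update, has
fewer pluses than a critical droplet. -/
def Subcritical (h : ℝ) (p : ZMod 2) (σ : Config L) : Prop :=
  plusCount (mix p σ (majority h σ)) < critCount h

lemma Subcritical.add_one (L_even : Even L) (L_gt : 2 < L) (L_large : 2 * critLength h ≤ L)
    (hσ : Subcritical h p σ)
    (hη : isingEnergy h (mix p σ η) < isingEnergy h (allMinus L) + activationEnergy h) :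
    Subcritical h (p + 1) η := by
  have h_lt := plusCount_mix_lt L_even L_gt L_large hσ
    ((halfEnergy_le_isingEnergy_mix L_even h p σ η).trans_lt hη) hη
  rw [← mix_add_one] at h_lt hη
  exact plusCount_mix_lt L_even L_gt L_large h_lt hη
    ((halfEnergy_le_isingEnergy_mix L_even h (p + 1) η σ).trans_lt hη)

lemma Subcritical.isingEnergy_allMinus_le (L_gt : 2 < L) (h_pos : 0 < h)
    (L_large : 2 * critLength h ≤ L) (hσ : Subcritical h p σ) :
    isingEnergy h (allMinus L) ≤ halfEnergy h p σ :=
  PCA.isingEnergy_allMinus_le L_gt h_pos L_large hσ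

/-! ### Constant halves -/

lemma halfEnergy_eq_of_eqOn_allPlus (L_even : Even L) (h_nonneg : 0 ≤ h)
    (hσ : Set.EqOn σ (allPlus L) (sublattice L p)) :
    halfEnergy h p σ = isingEnergy h (allPlus L) :=
  (halfEnergy_le_isingEnergy L_even h hσ.symm).antisymm (isingEnergy_allPlus_le h_nonneg _)

lemma mix_majority_eq_allMinus (L_even : Even L) (L_gt : 2 < L) (h_lt : h < 4)
    (hσ : Set.EqOn σ (allMinus L) (sublattice L p)) : mix p σ (majority h σ) = allMinus L := by
  refine (eq_mix hσ.symm fun x hx => ?_).symm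
  have h_field : S σ x = S (allMinus L) x := S_eq_of_eqOn L_even <| by
    rwa [show parity x = p + 1 from hx, CharTwo.add_cancel_right]
  rw [majority, h_field, S_allMinus L_gt, if_neg (by linarith), allMinus]

lemma halfEnergy_eq_of_eqOn_allMinus (L_even : Even L) (L_gt : 2 < L) (h_lt : h < 4)
    (hσ : Set.EqOn σ (allMinus L) (sublattice L p)) :
    halfEnergy h p σ = isingEnergy h (allMinus L) := by
  rw [halfEnergy, mix_majority_eq_allMinus L_even L_gt h_lt hσ]

lemma subcritical_of_eqOn_allMinus (L_even : Even L) (L_gt : 2 < L) (h_lt : h < 4)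
    (hσ : Set.EqOn σ (allMinus L) (sublattice L p)) : Subcritical h p σ := by
  rw [Subcritical, mix_majority_eq_allMinus L_even L_gt h_lt hσ, plusCount_allMinus]
  exact Nat.succ_pos _

lemma energy_allMinus (L_even : Even L) (L_gt : 2 < L) (h_lt : h < 4) :
    energy h (allMinus L) = isingEnergy h (allMinus L) + isingEnergy h (allMinus L) := by
  have h_half (p : ZMod 2) : halfEnergy h p (allMinus L) = isingEnergy h (allMinus L) :=
    halfEnergy_eq_of_eqOn_allMinus L_even L_gt h_lt (Set.eqOn_refl ..)
  rw [energy_eq_halfEnergy_add L_even h 0, h_half, h_half]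

lemma energy_mix_allPlus_allMinus (L_even : Even L) (L_gt : 2 < L) (h_nonneg : 0 ≤ h)
    (h_lt : h < 4) (p : ZMod 2) :
    energy h (mix p (allPlus L) (allMinus L))
      = isingEnergy h (allPlus L) + isingEnergy h (allMinus L) := by
  rw [energy_eq_halfEnergy_add L_even h p,
    halfEnergy_eq_of_eqOn_allPlus L_even h_nonneg (mix_eqOn_left p _ _),
    halfEnergy_eq_of_eqOn_allMinus L_even L_gt h_lt (mix_eqOn_right p _ _)]

end Barrier

/-! ### Square-shaped sets enumerated by the pairing function -/

section Enumeration

/-- Half the perimeter of the set of the first `j` pairs of natural numbers in the order of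
`Nat.pair`, which fills the squares `[0, l) × [0, l)` one after the other: the number of columns
plus the number of rows that meet the set. -/
def halfPerimeter (j : ℕ) : ℕ :=
  Nat.count (fun i => i.unpair.2 = 0) j + Nat.count (fun i => i.unpair.1 = 0) j

lemma halfPerimeter_succ (j : ℕ) : halfPerimeter (j + 1) = halfPerimeter j
    + (if j.unpair.1 = 0 then 1 else 0) + (if j.unpair.2 = 0 then 1 else 0) := by
  simp only [halfPerimeter, Nat.count_succ]
  ring

lemma unpair_lt {i l : ℕ} (hi : i < l * l) : i.unpair.1 < l ∧ i.unpair.2 < l := by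
  have h_le := Nat.max_sq_add_min_le_pair i.unpair.1 i.unpair.2
  rw [Nat.pair_unpair] at h_le
  refine max_lt_iff.1 (lt_of_pow_lt_pow_left₀ 2 l.zero_le ?_)
  lia

lemma count_unpair_fst_eq_zero_le {j l : ℕ} (hj : j ≤ l * l) :
    Nat.count (fun i => i.unpair.1 = 0) j ≤ l := by
  rw [Nat.count_eq_card_filter_range, ← card_range l]
  refine card_le_card_of_injOn (fun i => i.unpair.2) (fun i hi => ?_) fun i hi i' hi' h_eq => ?_
  · simp only [coe_filter, Set.mem_ofPred_eq, mem_range] at hi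
    exact mem_coe.2 (mem_range.2 (unpair_lt (hi.1.trans_le hj)).2)
  · simp only [coe_filter, Set.mem_ofPred_eq] at hi hi'
    exact Nat.pairEquiv.symm.injective (Prod.ext (hi.2.trans hi'.2.symm) h_eq)

lemma count_unpair_snd_eq_zero_le {j l : ℕ} (hj : j ≤ l * l + l) :
    Nat.count (fun i => i.unpair.2 = 0) j ≤ l := by
  rw [Nat.count_eq_card_filter_range, ← card_range l]
  refine card_le_card_of_injOn (fun i => i.unpair.1) (fun i hi => ?_) fun i hi i' hi' h_eq => ?_
  · simp only [coe_filter, Set.mem_ofPred_eq, mem_range] at hi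
    have h_pair : i.unpair.1 * i.unpair.1 + i.unpair.1 = i := by
      simpa [hi.2, Nat.pair] using Nat.pair_unpair i
    refine mem_coe.2 (mem_range.2 (not_le.1 fun h_ge => ?_))
    have := Nat.mul_le_mul h_ge h_ge
    lia
  · simp only [coe_filter, Set.mem_ofPred_eq] at hi hi'
    exact Nat.pairEquiv.symm.injective (Prod.ext h_eq (hi.2.trans hi'.2.symm))

lemma halfPerimeter_le_of_le_sq {j l : ℕ} (hj : j ≤ l * l) : halfPerimeter j ≤ 2 * l := by
  rw [halfPerimeter, two_mul]
  exact add_le_add (count_unpair_snd_eq_zero_le (hj.trans (Nat.le_add_right _ l)))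
    (count_unpair_fst_eq_zero_le hj)

lemma halfPerimeter_le_of_le_mul {j l : ℕ} (hj : j ≤ l * l + l) :
    halfPerimeter j ≤ 2 * l + 1 := by
  rw [halfPerimeter, two_mul, add_assoc]
  exact add_le_add (count_unpair_snd_eq_zero_le hj) (count_unpair_fst_eq_zero_le (by lia))

lemma halfPerimeter_le_add {k a b : ℕ} (hk : k ≤ a * b) : halfPerimeter k ≤ a + b := by
  obtain ⟨l, hl | hl⟩ := Nat.even_or_odd' (a + b)
  · rw [hl]
    refine halfPerimeter_le_of_le_sq (hk.trans ?_)
    nlinarith [four_mul_le_sq_add a b, congrArg (· ^ 2) hl]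
  · rw [hl]
    refine halfPerimeter_le_of_le_mul (hk.trans ?_)
    by_contra! h_lt
    have h_sum := two_mul_le_add_of_mul_pred_lt_mul (l := l + 1) (a := a) (b := b) (by lia)
    lia

/-- The energy, relative to all minuses, of a droplet made of the first `j` pairs. -/
def dropletEnergy (h : ℝ) (j : ℕ) : ℝ := 4 * halfPerimeter j - 2 * h * j

variable {h : ℝ}

lemma dropletEnergy_zero (h : ℝ) : dropletEnergy h 0 = 0 := by
  simp [dropletEnergy, halfPerimeter]

lemma dropletEnergy_one (h : ℝ) : dropletEnergy h 1 = 8 - 2 * h := by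
  simp only [dropletEnergy, halfPerimeter, Nat.count_succ, Nat.count_zero, Nat.unpair_zero]
  norm_num

lemma dropletEnergy_sq_le (h : ℝ) (n : ℕ) : dropletEnergy h (n * n) ≤ 2 * n * (4 - h * n) := by
  have h_perimeter : (halfPerimeter (n * n) : ℝ) ≤ 2 * n := by
    exact_mod_cast halfPerimeter_le_of_le_sq le_rfl
  rw [dropletEnergy, Nat.cast_mul]
  linarith

lemma dropletEnergy_sq_neg {n : ℕ} (hn : 4 < h * n) : dropletEnergy h (n * n) < 0 := by
  have h_pos : (0 : ℝ) < n := by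
    refine n.cast_nonneg.lt_of_ne fun h_zero => ?_
    rw [← h_zero] at hn
    linarith
  exact (dropletEnergy_sq_le h n).trans_lt (mul_neg_of_pos_of_neg (by positivity) (by linarith))

lemma dropletEnergy_sq_lt {n : ℕ} (hn : 1 < n) (h_lt : 4 < h * (n + 1)) :
    dropletEnergy h (n * n) < 8 - 2 * h := by
  have h_one : (1 : ℝ) < n := by exact_mod_cast hn
  nlinarith [dropletEnergy_sq_le h n]

/-- The left-hand side is maximal at the critical length, where equality holds. -/
lemma le_activationEnergy (h_pos : 0 < h) (l : ℕ) :
    8 * (l : ℝ) - 2 * h * (l * (l - 1) + 1) ≤ activationEnergy h := by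
  have h_lower := two_lt_mul_critLength h_pos
  have h_upper := mul_critLength_sub_one_le h_pos
  have h_factor : activationEnergy h - (8 * (l : ℝ) - 2 * h * (l * (l - 1) + 1))
      = ((critLength h : ℝ) - l) * (8 - 2 * h * ((critLength h : ℝ) + l - 1)) := by
    rw [activationEnergy]
    ring
  refine sub_nonneg.1 (h_factor ▸ ?_)
  rcases lt_trichotomy l (critLength h) with hl | rfl | hl
  · have hl : (l : ℝ) + 1 ≤ critLength h := by exact_mod_cast hl
    exact mul_nonneg (by linarith) (by nlinarith)
  · simp
  · have hl : (critLength h : ℝ) + 1 ≤ l := by exact_mod_cast hl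
    exact mul_nonneg_of_nonpos_of_nonpos (by linarith) (by nlinarith)

lemma eight_sub_le_activationEnergy (h_pos : 0 < h) : 8 - 2 * h ≤ activationEnergy h := by
  simpa using le_activationEnergy h_pos 1

lemma dropletEnergy_le_activationEnergy (h_pos : 0 < h) (h_le : h ≤ 4) (j : ℕ) :
    dropletEnergy h j ≤ activationEnergy h := by
  rcases j with _ | k
  · rw [dropletEnergy_zero]
    linarith [eight_sub_le_activationEnergy h_pos]
  set l := k.sqrt
  have h_lower : l * l ≤ k := k.sqrt_le
  have h_upper : k < (l + 1) * (l + 1) := k.lt_succ_sqrt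
  have h_crit := le_activationEnergy h_pos (l + 1)
  push_cast at h_crit
  rw [dropletEnergy, Nat.cast_succ]
  by_cases hk : k + 1 ≤ l * l + l
  · have h_perimeter : (halfPerimeter (k + 1) : ℝ) ≤ 2 * l + 1 := by
      exact_mod_cast halfPerimeter_le_of_le_mul hk
    have h_area : h * ((l : ℝ) * l) ≤ h * k := by gcongr; exact_mod_cast h_lower
    linarith [le_activationEnergy h_pos l]
  · have h_perimeter : (halfPerimeter (k + 1) : ℝ) ≤ 2 * (l + 1) := by
      exact_mod_cast halfPerimeter_le_of_le_sq (l := l + 1) (by lia)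
    have h_area : h * ((l : ℝ) * l + l) ≤ h * k := by
      gcongr
      exact_mod_cast (by lia : l * l + l ≤ k)
    linarith

lemma exists_first_dropletEnergy_lt {L : ℕ} (L_gt : 2 < L) (h_large : 4 < h * L) :
    ∃ N, 1 < N ∧ N ≤ (L - 1) * (L - 1) ∧ dropletEnergy h N < 8 - 2 * h ∧
      ∀ k, 0 < k → k < N → 8 - 2 * h ≤ dropletEnergy h k := by
  classical
  have h_sq : 0 < (L - 1) * (L - 1) ∧ dropletEnergy h ((L - 1) * (L - 1)) < 8 - 2 * h := by
    refine ⟨Nat.mul_pos (by lia) (by lia), dropletEnergy_sq_lt (by lia) ?_⟩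
    rwa [← Nat.cast_add_one, Nat.sub_add_cancel (by lia)]
  have h_ex : ∃ N, 0 < N ∧ dropletEnergy h N < 8 - 2 * h := ⟨_, h_sq⟩
  obtain ⟨hN_pos, hN_lt⟩ := Nat.find_spec h_ex
  refine ⟨Nat.find h_ex, ?_, Nat.find_min' h_ex h_sq, hN_lt, fun k hk hk_lt => ?_⟩
  · refine lt_of_le_of_ne hN_pos fun h_one => ?_
    rw [← h_one, dropletEnergy_one] at hN_lt
    exact lt_irrefl _ hN_lt
  · exact not_lt.1 fun h_lt => Nat.find_min h_ex hk_lt ⟨hk, h_lt⟩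

end Enumeration

/-! ### Droplets on the torus -/

section Droplet

variable {L : ℕ} {h : ℝ} {x₀ e e' : Site L} {s t : Config L} {i j : ℕ}

/-- The pair `(e, e')` consists of the two coordinate directions, in either order. -/
def IsFrame (e e' : Site L) : Prop :=
  e = (1, 0) ∧ e' = (0, 1) ∨ e = (0, 1) ∧ e' = (1, 0)

/-- The site with the coordinates of the `i`-th pair of natural numbers in the frame `(e, e')` with
origin `x₀`. -/
def dropletSite (x₀ e e' : Site L) (i : ℕ) : Site L := x₀ + i.unpair.1 • e + i.unpair.2 • e'

/-- The droplet with pluses at the first `j` sites `dropletSite x₀ e e' i`. -/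
def droplet (x₀ e e' : Site L) (j : ℕ) : Config L :=
  fun x => if ∃ i < j, dropletSite x₀ e e' i = x then 1 else -1

lemma droplet_eq_one_iff {x : Site L} :
    droplet x₀ e e' j x = 1 ↔ ∃ i < j, dropletSite x₀ e e' i = x := by
  rw [droplet]
  split_ifs with hx
  · exact iff_of_true rfl hx
  · exact iff_of_false (by decide) hx

lemma droplet_apply_of_lt (hij : i < j) : droplet x₀ e e' j (dropletSite x₀ e e' i) = 1 :=
  droplet_eq_one_iff.2 ⟨i, hij, rfl⟩

lemma droplet_zero (x₀ e e' : Site L) : droplet x₀ e e' 0 = allMinus L := by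
  ext1 x
  simp [droplet, allMinus]

lemma droplet_succ_of_ne {x : Site L} (hx : x ≠ dropletSite x₀ e e' j) :
    droplet x₀ e e' (j + 1) x = droplet x₀ e e' j x := by
  simp only [droplet, Nat.exists_lt_succ_right, hx.symm, or_false]

lemma dropletSite_zero (x₀ e e' : Site L) : dropletSite x₀ e e' 0 = x₀ := by
  simp [dropletSite]

lemma dropletSite_one (x₀ e e' : Site L) : dropletSite x₀ e e' 1 = x₀ + e' := by
  have h_unpair : Nat.unpair 1 = (0, 1) := Nat.unpair_pair 0 1
  simp [dropletSite, h_unpair]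

lemma exists_dropletSite_eq (he : IsFrame e e') {l : ℕ} (hi : i < l * l) :
    ∃ a < l, ∃ b < l, dropletSite x₀ e e' i = (x₀.1 + a, x₀.2 + b) := by
  obtain ⟨h₁, h₂⟩ := unpair_lt hi
  rcases he with ⟨rfl, rfl⟩ | ⟨rfl, rfl⟩
  · exact ⟨_, h₁, _, h₂, by ext <;> simp [dropletSite]⟩
  · exact ⟨_, h₂, _, h₁, by ext <;> simp [dropletSite]⟩

lemma dropletSite_injOn (he : IsFrame e e') :
    Set.InjOn (dropletSite x₀ e e') (Set.Iio (L * L)) := by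
  intro i hi j hj hij
  obtain ⟨hi₁, hi₂⟩ := unpair_lt hi
  obtain ⟨hj₁, hj₂⟩ := unpair_lt hj
  have h_cast := CharP.natCast_injOn_Iio (ZMod L) L
  refine Nat.pairEquiv.symm.injective ?_
  rcases he with ⟨rfl, rfl⟩ | ⟨rfl, rfl⟩ <;>
    simp only [dropletSite, Prod.smul_mk, nsmul_eq_mul, mul_one, mul_zero, Prod.ext_iff,
      Prod.fst_add, Prod.snd_add, add_zero, add_right_inj] at hij
  · exact Prod.ext (h_cast hi₁ hj₁ hij.1) (h_cast hi₂ hj₂ hij.2)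
  · exact Prod.ext (h_cast hi₁ hj₁ hij.2) (h_cast hi₂ hj₂ hij.1)

lemma droplet_apply_self (he : IsFrame e e') (hj : j < L * L) :
    droplet x₀ e e' j (dropletSite x₀ e e' j) = -1 :=
  if_neg fun ⟨_, hi, hij⟩ => hi.ne (dropletSite_injOn he (hi.trans hj) hj hij)

lemma droplet_succ (he : IsFrame e e') (hj : j < L * L) :
    droplet x₀ e e' (j + 1) = update (droplet x₀ e e' j) (dropletSite x₀ e e' j)
      (-droplet x₀ e e' j (dropletSite x₀ e e' j)) := by
  ext1 x
  rcases eq_or_ne x (dropletSite x₀ e e' j) with rfl | hx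
  · rw [update_self, droplet_apply_self he hj, neg_neg, droplet_apply_of_lt j.lt_succ_self]
  · rw [update_of_ne hx, droplet_succ_of_ne hx]

lemma droplet_sub_left (hj : j.unpair.1 ≠ 0) :
    droplet x₀ e e' j (dropletSite x₀ e e' j - e) = 1 := by
  obtain ⟨a, ha⟩ := Nat.exists_eq_succ_of_ne_zero hj
  refine droplet_eq_one_iff.2 ⟨Nat.pair a j.unpair.2, ?_, ?_⟩
  · conv_rhs => rw [← Nat.pair_unpair j, ha]
    exact Nat.pair_lt_pair_left _ a.lt_succ_self
  · simp only [dropletSite, Nat.unpair_pair, ha, Nat.succ_eq_add_one, add_smul, one_smul]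
    abel

lemma droplet_sub_right (hj : j.unpair.2 ≠ 0) :
    droplet x₀ e e' j (dropletSite x₀ e e' j - e') = 1 := by
  obtain ⟨b, hb⟩ := Nat.exists_eq_succ_of_ne_zero hj
  refine droplet_eq_one_iff.2 ⟨Nat.pair j.unpair.1 b, ?_, ?_⟩
  · conv_rhs => rw [← Nat.pair_unpair j, hb]
    exact Nat.pair_lt_pair_right _ b.lt_succ_self
  · simp only [dropletSite, Nat.unpair_pair, hb, Nat.succ_eq_add_one, add_smul, one_smul]
    abel

lemma natCast_ne_neg_one {a : ℕ} (ha : a < L - 1) : (a : ZMod L) ≠ -1 := by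
  rw [Ne, ← add_eq_zero_iff_eq_neg, ← Nat.cast_succ, ZMod.natCast_eq_zero_iff]
  exact Nat.not_dvd_of_pos_of_lt a.succ_pos (by lia)

lemma units_le_one (a : ℤˣ) : a ≤ 1 := by
  revert a
  decide

lemma neg_one_le_units (a : ℤˣ) : -1 ≤ a := by
  revert a
  decide

variable [NeZero L]

lemma S_eq_of_isFrame (L_gt : 2 < L) (he : IsFrame e e') (s : Config L) (x : Site L) :
    S s x = spin s (x + e) + spin s (x - e) + spin s (x + e') + spin s (x - e') := by
  rcases he with ⟨rfl, rfl⟩ | ⟨rfl, rfl⟩ <;> rw [S_eq_neighbors L_gt]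
  ring

lemma le_S_droplet (L_gt : 2 < L) (he : IsFrame e e') :
    -2 * ((if j.unpair.1 = 0 then 1 else 0) + (if j.unpair.2 = 0 then 1 else 0))
      ≤ S (droplet x₀ e e' j) (dropletSite x₀ e e' j) := by
  have h_ge (x : Site L) : -1 ≤ spin (droplet x₀ e e' j) x := (abs_le.1 (abs_spin _ x).le).1
  have h_left : 1 - 2 * (if j.unpair.1 = 0 then 1 else 0)
      ≤ spin (droplet x₀ e e' j) (dropletSite x₀ e e' j - e) := by
    split_ifs with hj
    · linarith [h_ge (dropletSite x₀ e e' j - e)]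
    · simp [spin, droplet_sub_left hj]
  have h_right : 1 - 2 * (if j.unpair.2 = 0 then 1 else 0)
      ≤ spin (droplet x₀ e e' j) (dropletSite x₀ e e' j - e') := by
    split_ifs with hj
    · linarith [h_ge (dropletSite x₀ e e' j - e')]
    · simp [spin, droplet_sub_right hj]
  rw [S_eq_of_isFrame L_gt he]
  linarith [h_ge (dropletSite x₀ e e' j + e), h_ge (dropletSite x₀ e e' j + e')]

lemma isingEnergy_droplet_le (L_even : Even L) (L_gt : 2 < L) (h : ℝ) (he : IsFrame e e')
    (hj : j ≤ L * L) :
    isingEnergy h (droplet x₀ e e' j) ≤ isingEnergy h (allMinus L) + dropletEnergy h j := by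
  induction j with
  | zero => rw [droplet_zero, dropletEnergy_zero, add_zero]
  | succ j ih =>
    have h_field := le_S_droplet L_gt he (x₀ := x₀) (j := j)
    have h_spin : spin (droplet x₀ e e' j) (dropletSite x₀ e e' j) = -1 := by
      simp [spin, droplet_apply_self he hj]
    have h_prev := ih (Nat.le_of_succ_le hj)
    rw [dropletEnergy] at h_prev ⊢
    rw [droplet_succ he hj, isingEnergy_flip L_even, h_spin, halfPerimeter_succ]
    push_cast
    linarith

/-- The row and the column just before `x₀` stay empty, so `t` has no full line. -/
lemma dropletEnergy_plusCount_le (L_gt : 2 < L) (h : ℝ) (he : IsFrame e e')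
    (hj : j ≤ (L - 1) * (L - 1)) (ht : t ≤ droplet x₀ e e' j) :
    isingEnergy h (allMinus L) + dropletEnergy h (plusCount t) ≤ isingEnergy h t := by
  have h_coord {x : Site L} (hx : t x = 1) : x.1 ≠ x₀.1 - 1 ∧ x.2 ≠ x₀.2 - 1 := by
    obtain ⟨i, hi, rfl⟩ := droplet_eq_one_iff.1 ((units_le_one _).antisymm (hx ▸ ht x))
    obtain ⟨a, ha, b, hb, h_eq⟩ := exists_dropletSite_eq (x₀ := x₀) he (hi.trans_le hj)
    simp only [h_eq, sub_eq_add_neg, ne_eq, add_right_inj]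
    exact ⟨natCast_ne_neg_one ha, natCast_ne_neg_one hb⟩
  have h_area : plusCount t ≤ #(mixedCols t) * #(mixedRows t) :=
    card_filter_eq_le_of_no_constant_line (fun y => ⟨x₀.1 - 1, fun hx => (h_coord hx).1 rfl⟩)
      fun x => ⟨x₀.2 - 1, fun hx => (h_coord hx).2 rfl⟩
  have h_perimeter : (halfPerimeter (plusCount t) : ℝ) ≤ #(mixedCols t) + #(mixedRows t) := by
    exact_mod_cast halfPerimeter_le_add h_area
  rw [dropletEnergy]
  linarith [four_mul_card_mixed_le L_gt h t]

end Droplet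

/-! ### Descents in the Ising landscape -/

section Descent

variable {L : ℕ} {h g : ℝ} {x₀ e e' : Site L} {s : Config L} {a b : Site L} {j N : ℕ}

lemma allMinus_le (s : Config L) : allMinus L ≤ s :=
  fun x => neg_one_le_units (s x)

lemma sup_droplet_zero (s : Config L) : s ⊔ droplet x₀ e e' 0 = s := by
  rw [droplet_zero, sup_eq_left]
  exact allMinus_le s

lemma sup_droplet_one (hx₀ : s x₀ = 1) : s ⊔ droplet x₀ e e' 1 = s := by
  rw [sup_eq_left]
  intro x
  rcases eq_or_ne x x₀ with rfl | hx
  · rw [hx₀]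
    exact units_le_one _
  · rw [droplet_succ_of_ne (by rwa [dropletSite_zero]), droplet_zero]
    exact allMinus_le s x

variable [NeZero L]

/-- From `s` the Ising energy can be lowered without ever exceeding its value at `s` by more than
`g`. A step may change all the spins of one parity, which is what the automaton can do at once; its
energy is charged to its starting point because the end point `t` lies below `s` anyway. -/
def HasDescent (h g : ℝ) (s : Config L) : Prop :=
  ∃ t, isingEnergy h t < isingEnergy h s ∧
    Relation.ReflTransGen (fun r r' => (∃ q, Set.EqOn r r' (sublattice L q)) ∧
      isingEnergy h r ≤ isingEnergy h s + g) s t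

lemma exists_frame (ha : s a = 1) (hb : s b = -1) :
    ∃ x₀ e e', IsFrame e e' ∧ s x₀ = 1 ∧ s (x₀ + e') = -1 := by
  simp only [← Int.units_ne_iff_eq_neg] at hb ⊢
  by_cases h_row : ∃ i, s (i, a.2) ≠ 1
  · obtain ⟨i, hi⟩ := h_row
    obtain ⟨k, hk, hk'⟩ := exists_and_not_add_one (P := fun k => s (k, a.2) = 1) ha hi
    exact ⟨(k, a.2), (0, 1), (1, 0), .inr ⟨rfl, rfl⟩, hk, by simpa using hk'⟩
  · push Not at h_row
    obtain ⟨k, hk, hk'⟩ := exists_and_not_add_one (P := fun k => s (b.1, k) = 1) (h_row b.1) hb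
    exact ⟨(b.1, k), (1, 0), (0, 1), .inl ⟨rfl, rfl⟩, hk, by simpa using hk'⟩

lemma hasDescent_of_sup_droplet
    (h_le : ∀ j < N, isingEnergy h (s ⊔ droplet x₀ e e' j) ≤ isingEnergy h s + g)
    (h_lt : isingEnergy h (s ⊔ droplet x₀ e e' N) < isingEnergy h s) : HasDescent h g s := by
  refine ⟨_, h_lt, ?_⟩
  suffices h_gen : ∀ j ≤ N, Relation.ReflTransGen (fun r r' => (∃ q, Set.EqOn r r' (sublattice L q))
      ∧ isingEnergy h r ≤ isingEnergy h s + g) s (s ⊔ droplet x₀ e e' j) from h_gen N le_rfl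
  intro j
  induction j with
  | zero =>
    rw [sup_droplet_zero]
    exact fun _ => .refl
  | succ j ih =>
    refine fun hj => (ih (Nat.le_of_succ_le hj)).tail
      ⟨⟨parity (dropletSite x₀ e e' j) + 1, fun x hx => ?_⟩, h_le j hj⟩
    have hx_ne : x ≠ dropletSite x₀ e e' j := by
      rintro rfl
      exact ne_iff_eq_add_one.2 hx rfl
    rw [Pi.sup_apply, Pi.sup_apply, droplet_succ_of_ne hx_ne]

lemma hasDescent_allMinus (L_even : Even L) (L_gt : 2 < L) (h_pos : 0 < h) (h_le : h ≤ 4)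
    (L_large : 2 * critLength h ≤ L) : HasDescent h (activationEnergy h) (allMinus L) := by
  have h_droplet {j : ℕ} (hj : j ≤ L * L) :
      isingEnergy h (allMinus L ⊔ droplet 0 (1, 0) (0, 1) j)
        ≤ isingEnergy h (allMinus L) + dropletEnergy h j := by
    rw [sup_eq_right.2 (allMinus_le _)]
    exact isingEnergy_droplet_le L_even L_gt h (.inl ⟨rfl, rfl⟩) hj
  refine hasDescent_of_sup_droplet (x₀ := 0) (e := (1, 0)) (e' := (0, 1)) (N := L * L) ?_ ?_
  · intro j hj
    linarith [h_droplet hj.le, dropletEnergy_le_activationEnergy h_pos h_le j]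
  · linarith [h_droplet le_rfl, dropletEnergy_sq_neg (four_lt_mul_side h_pos L_large)]

lemma plusCount_inf_droplet_pos (hx₀ : s x₀ = 1) (hj : 0 < j) :
    0 < plusCount (s ⊓ droplet x₀ e e' j) := by
  have h_drop : droplet x₀ e e' j x₀ = 1 := droplet_eq_one_iff.2 ⟨0, hj, dropletSite_zero _ _ _⟩
  refine card_pos.2 ⟨x₀, ?_⟩
  simp [hx₀, h_drop]

lemma plusCount_inf_droplet_lt (hx₁ : s (x₀ + e') = -1) (hj : 1 < j) :
    plusCount (s ⊓ droplet x₀ e e' j) < j := by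
  have h_sub : ({x | (s ⊓ droplet x₀ e e' j) x = 1} : Finset (Site L))
      ⊆ ((range j).erase 1).image (dropletSite x₀ e e') := by
    intro x hx
    obtain ⟨hsx, hdx⟩ := le_inf_iff.1 (mem_filter.1 hx).2.ge
    obtain ⟨i, hi, rfl⟩ := droplet_eq_one_iff.1 ((units_le_one _).antisymm hdx)
    refine mem_image_of_mem _ (mem_erase.2 ⟨?_, mem_range.2 hi⟩)
    rintro rfl
    rw [dropletSite_one, hx₁] at hsx
    exact absurd hsx (by decide)
  have h_card := (card_le_card h_sub).trans card_image_le
  rw [card_erase_of_mem (mem_range.2 hj), card_range] at h_card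
  exact h_card.trans_lt (Nat.sub_lt (by lia) one_pos)

/-- By submodularity, adding a droplet to `s` costs at most the energy of the droplet minus that of
its part already present in `s`, which is a nonempty proper part. -/
lemma isingEnergy_sup_droplet_le (L_even : Even L) (L_gt : 2 < L) (he : IsFrame e e')
    (hx₀ : s x₀ = 1) (hx₁ : s (x₀ + e') = -1) (hj : 1 < j) (hj_le : j ≤ (L - 1) * (L - 1))
    (h_min : ∀ k, 0 < k → k < j → 8 - 2 * h ≤ dropletEnergy h k) :
    isingEnergy h (s ⊔ droplet x₀ e e' j) ≤ isingEnergy h s + dropletEnergy h j - (8 - 2 * h) := by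
  have hj_sq : j ≤ L * L := hj_le.trans (Nat.mul_le_mul (Nat.sub_le _ _) (Nat.sub_le _ _))
  have h_inf := dropletEnergy_plusCount_le L_gt h he hj_le (t := s ⊓ droplet x₀ e e' j) inf_le_right
  have h_part : 8 - 2 * h ≤ dropletEnergy h (plusCount (s ⊓ droplet x₀ e e' j)) :=
    h_min _ (plusCount_inf_droplet_pos hx₀ (by lia)) (plusCount_inf_droplet_lt hx₁ hj)
  linarith [isingEnergy_sup_add_isingEnergy_inf_le h s (droplet x₀ e e' j),
    isingEnergy_droplet_le L_even L_gt h he hj_sq (x₀ := x₀)]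

lemma hasDescent_of_nonconstant (L_even : Even L) (L_gt : 2 < L) (h_pos : 0 < h) (h_le : h ≤ 4)
    (L_large : 2 * critLength h ≤ L) (ha : s a = 1) (hb : s b = -1) :
    HasDescent h (activationEnergy h - (8 - 2 * h)) s := by
  obtain ⟨x₀, e, e', he, hx₀, hx₁⟩ := exists_frame ha hb
  obtain ⟨N, hN, hN_le, hN_lt, h_min⟩ :=
    exists_first_dropletEnergy_lt L_gt (four_lt_mul_side h_pos L_large)
  have h_sup {j : ℕ} (hj : 1 < j) (hjN : j ≤ N) := isingEnergy_sup_droplet_le L_even L_gt he hx₀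
    hx₁ hj (hjN.trans hN_le) fun k hk hkj => h_min k hk (hkj.trans_le hjN)
  refine hasDescent_of_sup_droplet (x₀ := x₀) (e := e) (e' := e') (N := N) (fun j hj => ?_) ?_
  · have h_start : isingEnergy h s ≤ isingEnergy h s + (activationEnergy h - (8 - 2 * h)) := by
      linarith [eight_sub_le_activationEnergy h_pos]
    match j, hj with
    | 0, _ => rwa [sup_droplet_zero]
    | 1, _ => rwa [sup_droplet_one hx₀]
    | j + 2, hj =>
      linarith [h_sup (by lia) hj.le, dropletEnergy_le_activationEnergy h_pos h_le (j + 2)]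
  · linarith [h_sup hN le_rfl]

end Descent

/-! ### Bounds on the stability level -/

section Stability

variable {L : ℕ} [NeZero L] {h g : ℝ} {p q : ZMod 2} {σ η : Config L}

lemma le_height_of_invariant {c : ℝ} {I : Config L → Prop}
    (hI : ∀ ξ ζ, I ξ → commHeight h ξ ζ < c → I ζ) {n : ℕ} {ω : Fin (n + 1) → Config L}
    (h_first : I (ω 0)) (h_last : ¬I (ω (Fin.last n))) : c ≤ height h n ω := by
  contrapose! h_last with h_height
  cases n with
  | zero => exact h_first
  | succ n =>
    have h_step (i : Fin (n + 1)) : commHeight h (ω i.castSucc) (ω i.succ) < c :=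
      (sup'_lt_iff univ_nonempty).1 h_height i (mem_univ i)
    exact Fin.induction (motive := fun i => I (ω i)) h_first (fun i hi => hI _ _ hi (h_step i)) _

lemma le_stabilityLevel_of_invariant {I : Config L → Prop}
    (hI : ∀ ξ ζ, I ξ → commHeight h ξ ζ < energy h σ + g → I ζ) (hσ : I σ)
    (h_bot : ∀ ξ, I ξ → energy h σ ≤ energy h ξ) : (g : EReal) ≤ stabilityLevel h σ := by
  rw [stabilityLevel, EReal.le_sub_iff_add_le (by simp) (by simp), add_comm, ← EReal.coe_add]
  refine le_iInf₂ fun η hη => le_iInf₂ fun n ω => le_iInf₂ fun h_first h_last => ?_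
  refine EReal.coe_le_coe_iff.2 (le_height_of_invariant hI (h_first ▸ hσ) fun hI_last => ?_)
  exact (h_bot η (h_last ▸ hI_last)).not_gt hη

lemma le_stabilityLevel_allMinus (L_even : Even L) (L_gt : 2 < L) (h_pos : 0 < h) (h_lt : h < 4)
    (L_large : 2 * critLength h ≤ L) :
    (activationEnergy h : EReal) ≤ stabilityLevel h (allMinus L) := by
  have h_energy := energy_allMinus L_even L_gt h_lt
  refine le_stabilityLevel_of_invariant (I := fun ξ => ∀ p, Subcritical h p ξ) ?_
    (fun p => subcritical_of_eqOn_allMinus L_even L_gt h_lt (Set.eqOn_refl ..)) ?_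
  · intro ξ η hξ h_height p
    rw [commHeight_eq_isingEnergy_add L_even h (p + 1), h_energy] at h_height
    have h_other := ((hξ (p + 1 + 1)).isingEnergy_allMinus_le L_gt h_pos L_large).trans
      (halfEnergy_le_isingEnergy_mix L_even h (p + 1 + 1) ξ η)
    simpa only [CharTwo.add_cancel_right] using
      (hξ (p + 1)).add_one L_even L_gt L_large (by linarith)
  · intro ξ hξ
    rw [energy_eq_halfEnergy_add L_even h 0 ξ, h_energy]
    exact add_le_add ((hξ _).isingEnergy_allMinus_le L_gt h_pos L_large)
      ((hξ _).isingEnergy_allMinus_le L_gt h_pos L_large)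

lemma le_stabilityLevel_mix_allPlus_allMinus (L_even : Even L) (L_gt : 2 < L) (h_pos : 0 < h)
    (h_lt : h < 4) (L_large : 2 * critLength h ≤ L) (p : ZMod 2) :
    (activationEnergy h : EReal) ≤ stabilityLevel h (mix p (allPlus L) (allMinus L)) := by
  have h_energy := energy_mix_allPlus_allMinus L_even L_gt h_pos.le h_lt p
  refine le_stabilityLevel_of_invariant (I := fun ξ => ∃ q, Subcritical h q ξ) ?_
    ⟨p + 1, subcritical_of_eqOn_allMinus L_even L_gt h_lt (mix_eqOn_right p _ _)⟩ ?_
  · rintro ξ η ⟨q, hq⟩ h_height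
    rw [commHeight_eq_isingEnergy_add L_even h q, h_energy] at h_height
    have h_other := isingEnergy_allPlus_le h_pos.le (mix (q + 1) ξ η)
    exact ⟨q + 1, hq.add_one L_even L_gt L_large (by linarith)⟩
  · rintro ξ ⟨q, hq⟩
    rw [energy_eq_halfEnergy_add L_even h q ξ, h_energy, add_comm]
    exact add_le_add (hq.isingEnergy_allMinus_le L_gt h_pos L_large)
      (isingEnergy_allPlus_le h_pos.le _)

lemma exists_relSeries_of_reflTransGen {α : Type*} {R : α → α → Prop} {a b : α}
    (hab : Relation.ReflTransGen R a b) :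
    ∃ ω : RelSeries {(x, y) | R x y}, ω.head = a ∧ ω.last = b := by
  induction hab with
  | refl => exact ⟨.singleton _ a, rfl, rfl⟩
  | @tail b c _ hbc ih =>
    obtain ⟨ω, h_head, rfl⟩ := ih
    exact ⟨ω.snoc c hbc, by rw [RelSeries.head_snoc, h_head], RelSeries.last_snoc ..⟩

lemma stabilityLevel_le_of_reflTransGen (hη : energy h η < energy h σ)
    (h_reach : Relation.ReflTransGen (fun ξ ζ => commHeight h ξ ζ ≤ energy h σ + g) σ η) :
    stabilityLevel h σ ≤ g := by
  obtain ⟨⟨n, ω, h_step⟩, h_first, h_last⟩ := exists_relSeries_of_reflTransGen h_reach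
  have h_height : height h n ω ≤ energy h σ + g := by
    cases n with
    | zero => exact absurd (h_first.symm.trans h_last ▸ hη) (lt_irrefl _)
    | succ n => exact sup'_le univ_nonempty _ fun i _ => h_step i
  refine EReal.sub_le_of_le_add' ((iInf₂_le η hη).trans ?_)
  refine (iInf₂_le n ω).trans ((iInf₂_le h_first h_last).trans ?_)
  exact_mod_cast h_height

/-- `ω'` copies `s` on the sublattice `q + 1` and obeys the majority rule of `ω` on the other. -/
lemma exists_commHeight_eq_of_eqOn (L_even : Even L) (h : ℝ) {s ω : Config L}
    (hω : Set.EqOn ω s (sublattice L q)) :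
    ∃ ω', Set.EqOn ω' s (sublattice L (q + 1)) ∧
      commHeight h ω ω' = isingEnergy h s + halfEnergy h (q + 1) ω ∧
      halfEnergy h q ω' ≤ halfEnergy h (q + 1) ω := by
  have h_left : mix q ω (mix (q + 1) s (majority h ω)) = s :=
    (eq_mix hω.symm (mix_eqOn_left ..).symm).symm
  have h_right : mix (q + 1) ω (mix (q + 1) s (majority h ω)) = mix (q + 1) ω (majority h ω) :=
    (eq_mix (mix_eqOn_left ..) ((mix_eqOn_right ..).trans (mix_eqOn_right ..).symm).symm).symm
  refine ⟨mix (q + 1) s (majority h ω), mix_eqOn_left .., ?_, ?_⟩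
  · rw [commHeight_eq_isingEnergy_add L_even h q, h_left, h_right, halfEnergy]
  · refine halfEnergy_le_isingEnergy L_even h ?_
    rw [mix_add_one, mix_add_one]
    exact (mix_eqOn_left ..).trans (mix_eqOn_left ..).symm

lemma stabilityLevel_le_of_hasDescent (L_even : Even L)
    (h_descent : HasDescent h g (mix p σ (majority h σ))) : stabilityLevel h σ ≤ g := by
  obtain ⟨t, ht_lt, h_reach⟩ := h_descent
  obtain ⟨ω, q, hσω, hω, h_half⟩ : ∃ ω q,
      Relation.ReflTransGen (fun ξ ζ => commHeight h ξ ζ ≤ energy h σ + g) σ ω ∧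
      Set.EqOn ω t (sublattice L q) ∧ halfEnergy h (q + 1) ω ≤ halfEnergy h (p + 1) σ := by
    clear ht_lt
    induction h_reach with
    | refl => exact ⟨σ, p, .refl, (mix_eqOn_left ..).symm, le_rfl⟩
    | @tail r r' _ hr ih =>
      obtain ⟨ω, q, hσω, hω, h_half⟩ := ih
      obtain ⟨⟨q', hq'⟩, h_le⟩ := hr
      by_cases hqq : q' = q
      · exact ⟨ω, q, hσω, hω.trans (hqq ▸ hq'), h_half⟩
      · obtain ⟨ω', hω', h_height, h_half'⟩ := exists_commHeight_eq_of_eqOn L_even h hω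
        obtain rfl : q' = q + 1 := ne_iff_eq_add_one.1 hqq
        refine ⟨ω', q + 1, hσω.tail ?_, hω'.trans hq', ?_⟩
        · rw [h_height, energy_eq_halfEnergy_add L_even h p]
          rw [← halfEnergy] at h_le
          linarith
        · rw [CharTwo.add_cancel_right]
          exact h_half'.trans h_half
  refine stabilityLevel_le_of_reflTransGen ?_ hσω
  have h_left := halfEnergy_le_isingEnergy L_even h hω.symm
  rw [← halfEnergy] at ht_lt
  rw [energy_eq_halfEnergy_add L_even h q, energy_eq_halfEnergy_add L_even h p]
  linarith

lemma stabilityLevel_lt_of_nonconstant (L_even : Even L) (L_gt : 2 < L) (h_pos : 0 < h)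
    (h_lt : h < 4) (L_large : 2 * critLength h ≤ L) {a b : Site L} (ha : a ∈ sublattice L p)
    (hb : b ∈ sublattice L p) (hσa : σ a = 1) (hσb : σ b = -1) :
    stabilityLevel h σ < activationEnergy h := by
  have h_descent := hasDescent_of_nonconstant L_even L_gt h_pos h_lt.le L_large
    ((mix_eqOn_left p σ (majority h σ) ha).trans hσa)
    ((mix_eqOn_left p σ (majority h σ) hb).trans hσb)
  refine (stabilityLevel_le_of_hasDescent L_even h_descent).trans_lt (EReal.coe_lt_coe_iff.2 ?_)
  linarith

lemma stabilityLevel_le_of_eqOn_allMinus (L_even : Even L) (L_gt : 2 < L) (h_pos : 0 < h)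
    (h_lt : h < 4) (L_large : 2 * critLength h ≤ L)
    (hσ : Set.EqOn σ (allMinus L) (sublattice L p)) :
    stabilityLevel h σ ≤ activationEnergy h := by
  refine stabilityLevel_le_of_hasDescent (p := p) L_even ?_
  rw [mix_majority_eq_allMinus L_even L_gt h_lt hσ]
  exact hasDescent_allMinus L_even L_gt h_pos h_lt.le L_large

end Stability

/-! ### The ground state and the metastable states -/

section Metastable

variable {L : ℕ} {h : ℝ} {σ : Config L}

lemma allMinus_ne_allPlus : allMinus L ≠ allPlus L := fun h_eq =>
  absurd (congrFun h_eq 0) (by unfold allMinus allPlus; decide)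

variable [NeZero L]

lemma natCast_val_add_val (x : Site L) : ((x.1.val + x.2.val : ℕ) : ZMod 2) = parity x := by
  rw [Nat.cast_add, ZMod.natCast_val, ZMod.natCast_val, parity]

lemma checkerEven_eq_mix : checkerEven L = mix 0 (allPlus L) (allMinus L) := by
  refine eq_mix (fun x hx => Even.neg_one_pow ?_) fun x hx => Odd.neg_one_pow ?_
  · rwa [← ZMod.natCast_eq_zero_iff_even, natCast_val_add_val]
  · rwa [← ZMod.natCast_eq_one_iff_odd, natCast_val_add_val, ← zero_add (1 : ZMod 2)]

lemma checkerOdd_eq_mix : checkerOdd L = mix 1 (allPlus L) (allMinus L) := by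
  refine eq_mix (fun x hx => Even.neg_one_pow ?_) fun x hx => Odd.neg_one_pow ?_
  · rw [← ZMod.natCast_eq_zero_iff_even, Nat.cast_succ, natCast_val_add_val, CharTwo.add_eq_zero]
    exact hx
  · rw [← ZMod.natCast_eq_one_iff_odd, Nat.cast_succ, natCast_val_add_val, add_eq_right]
    exact hx.trans CharTwo.two_eq_zero

lemma eqOn_allPlus_or_eqOn_allMinus {p : ZMod 2}
    (hσ : ∀ a ∈ sublattice L p, ∀ b ∈ sublattice L p, σ a = 1 → σ b ≠ -1) :
    Set.EqOn σ (allPlus L) (sublattice L p) ∨ Set.EqOn σ (allMinus L) (sublattice L p) := by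
  by_cases h_plus : ∃ a ∈ sublattice L p, σ a = 1
  · obtain ⟨a, ha, hσa⟩ := h_plus
    exact .inl fun b hb => (Int.units_eq_one_or (σ b)).resolve_right (hσ a ha b hb hσa)
  · push Not at h_plus
    exact .inr fun b hb => Int.units_ne_iff_eq_neg.1 (h_plus b hb)

lemma eq_of_constant_on_sublattices
    (hσ : ∀ p, ∀ a ∈ sublattice L p, ∀ b ∈ sublattice L p, σ a = 1 → σ b ≠ -1) :
    σ = allPlus L ∨ σ = allMinus L ∨ σ = checkerEven L ∨ σ = checkerOdd L := by
  have h_odd : checkerOdd L = mix 0 (allMinus L) (allPlus L) := by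
    rw [checkerOdd_eq_mix, ← zero_add (1 : ZMod 2), mix_add_one]
  rw [checkerEven_eq_mix, h_odd]
  rcases eqOn_allPlus_or_eqOn_allMinus (hσ 0) with h₀ | h₀ <;>
    rcases eqOn_allPlus_or_eqOn_allMinus (hσ (0 + 1)) with h₁ | h₁
  · exact .inl ((eq_mix h₀ h₁).trans (mix_self _ _))
  · exact .inr (.inr (.inl (eq_mix h₀ h₁)))
  · exact .inr (.inr (.inr (eq_mix h₀ h₁)))
  · exact .inr (.inl ((eq_mix h₀ h₁).trans (mix_self _ _)))

lemma energy_allPlus_lt (L_even : Even L) (h_pos : 0 < h) (hσ : σ ≠ allPlus L) :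
    energy h (allPlus L) < energy h σ := by
  obtain ⟨x, hx⟩ := Function.ne_iff.1 hσ
  have h_half (p : ZMod 2) : halfEnergy h p (allPlus L) = isingEnergy h (allPlus L) :=
    halfEnergy_eq_of_eqOn_allPlus L_even h_pos.le (Set.eqOn_refl ..)
  rw [energy_eq_halfEnergy_add L_even h (parity x), energy_eq_halfEnergy_add L_even h (parity x),
    h_half, h_half]
  refine add_lt_add_of_lt_of_le (isingEnergy_allPlus_lt h_pos fun h_eq => hx ?_)
    (isingEnergy_allPlus_le h_pos.le _)
  rw [← h_eq, mix_eqOn_left (parity x) σ _ rfl]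

lemma groundStates_eq (L_even : Even L) (h_pos : 0 < h) : groundStates L h = {allPlus L} := by
  ext σ
  rw [Set.mem_singleton_iff]
  constructor
  · intro hσ
    by_contra h_ne
    exact (hσ (allPlus L)).not_gt (energy_allPlus_lt L_even h_pos h_ne)
  · rintro rfl η
    rcases eq_or_ne η (allPlus L) with rfl | hη
    · exact le_rfl
    · exact (energy_allPlus_lt L_even h_pos hη).le

lemma stabilityLevel_eq_top (hσ : σ ∈ groundStates L h) : stabilityLevel h σ = ⊤ := by
  have h_empty : lowerSet h σ = ∅ :=
    Set.eq_empty_iff_forall_notMem.2 fun η hη => (hσ η).not_gt hη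
  simp [stabilityLevel, minimaxSet, h_empty]

lemma activationEnergy_pos (h_pos : 0 < h) (h_lt : h < 4) : 0 < activationEnergy h := by
  linarith [eight_sub_le_activationEnergy h_pos]

lemma stabilityLevel_mix_allPlus_allMinus (L_even : Even L) (L_gt : 2 < L) (h_pos : 0 < h)
    (h_lt : h < 4) (L_large : 2 * critLength h ≤ L) (p : ZMod 2) :
    stabilityLevel h (mix p (allPlus L) (allMinus L)) = activationEnergy h :=
  (stabilityLevel_le_of_eqOn_allMinus L_even L_gt h_pos h_lt L_large
    (mix_eqOn_right p _ _)).antisymm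
    (le_stabilityLevel_mix_allPlus_allMinus L_even L_gt h_pos h_lt L_large p)

lemma stabilityLevel_eq_activationEnergy (L_even : Even L) (L_gt : 2 < L) (h_pos : 0 < h)
    (h_lt : h < 4) (L_large : 2 * critLength h ≤ L)
    (hσ : σ = allMinus L ∨ σ = checkerEven L ∨ σ = checkerOdd L) :
    stabilityLevel h σ = activationEnergy h := by
  rcases hσ with rfl | rfl | rfl
  · exact (stabilityLevel_le_of_eqOn_allMinus (p := 0) L_even L_gt h_pos h_lt L_large
      (Set.eqOn_refl ..)).antisymm (le_stabilityLevel_allMinus L_even L_gt h_pos h_lt L_large)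
  · rw [checkerEven_eq_mix]
    exact stabilityLevel_mix_allPlus_allMinus L_even L_gt h_pos h_lt L_large 0
  · rw [checkerOdd_eq_mix]
    exact stabilityLevel_mix_allPlus_allMinus L_even L_gt h_pos h_lt L_large 1

lemma stabilityLevel_lt_activationEnergy (L_even : Even L) (L_gt : 2 < L) (h_pos : 0 < h)
    (h_lt : h < 4) (L_large : 2 * critLength h ≤ L) (h_plus : σ ≠ allPlus L)
    (hσ : ¬(σ = allMinus L ∨ σ = checkerEven L ∨ σ = checkerOdd L)) :
    stabilityLevel h σ < activationEnergy h := by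
  contrapose! hσ with h_le
  refine (eq_of_constant_on_sublattices fun p a ha b hb hσa hσb => ?_).resolve_left h_plus
  exact h_le.not_gt
    (stabilityLevel_lt_of_nonconstant L_even L_gt h_pos h_lt L_large ha hb hσa hσb)

lemma commEnergy_eq (L_even : Even L) (L_gt : 2 < L) (h_pos : 0 < h) (h_lt : h < 4)
    (L_large : 2 * critLength h ≤ L) : commEnergy L h = activationEnergy h := by
  rw [commEnergy, groundStates_eq L_even h_pos]
  refine le_antisymm (iSup₂_le fun σ h_plus => ?_) ?_
  · by_cases hσ : σ = allMinus L ∨ σ = checkerEven L ∨ σ = checkerOdd L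
    · exact (stabilityLevel_eq_activationEnergy L_even L_gt h_pos h_lt L_large hσ).le
    · exact (stabilityLevel_lt_activationEnergy L_even L_gt h_pos h_lt L_large h_plus hσ).le
  · exact le_iSup₂_of_le (allMinus L) allMinus_ne_allPlus
      (stabilityLevel_eq_activationEnergy L_even L_gt h_pos h_lt L_large (.inl rfl)).ge

lemma metastableStates_eq (L_even : Even L) (L_gt : 2 < L) (h_pos : 0 < h) (h_lt : h < 4)
    (L_large : 2 * critLength h ≤ L) :
    metastableStates L h = {allMinus L, checkerEven L, checkerOdd L} := by
  ext σ
  rw [metastableStates, commEnergy_eq L_even L_gt h_pos h_lt L_large]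
  refine ⟨fun hσ => ?_, stabilityLevel_eq_activationEnergy L_even L_gt h_pos h_lt L_large⟩
  have h_level : stabilityLevel h σ = activationEnergy h := hσ
  have h_plus : σ ≠ allPlus L := by
    rintro rfl
    have h_ground : allPlus L ∈ groundStates L h := (groundStates_eq L_even h_pos).ge rfl
    exact EReal.coe_ne_top _ (h_level.symm.trans (stabilityLevel_eq_top h_ground))
  by_contra h_other
  exact (stabilityLevel_lt_activationEnergy L_even L_gt h_pos h_lt L_large h_plus h_other).ne
    h_level

lemma energy_checkerEven_eq_energy_checkerOdd (L_even : Even L) (L_gt : 2 < L) (h_nonneg : 0 ≤ h)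
    (h_lt : h < 4) : energy h (checkerEven L) = energy h (checkerOdd L) := by
  rw [checkerEven_eq_mix, checkerOdd_eq_mix, energy_mix_allPlus_allMinus L_even L_gt h_nonneg h_lt,
    energy_mix_allPlus_allMinus L_even L_gt h_nonneg h_lt]

lemma energy_checkerEven_lt_energy_allMinus (L_even : Even L) (L_gt : 2 < L) (h_pos : 0 < h)
    (h_lt : h < 4) : energy h (checkerEven L) < energy h (allMinus L) := by
  rw [checkerEven_eq_mix, energy_mix_allPlus_allMinus L_even L_gt h_pos.le h_lt,
    energy_allMinus L_even L_gt h_lt, add_lt_add_iff_right]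
  exact isingEnergy_allPlus_lt h_pos allMinus_ne_allPlus

end Metastable

end

end PCA

theorem mainTheorem3_general (L : ℕ) [NeZero L] (h : ℝ) (h_pos : 0 < h) (h_lt : h < 4)
    (L_even : Even L) (L_gt : 2 < L) (L_large : 2 * PCA.critLength h ≤ L) :
    PCA.groundStates L h = {PCA.allPlus L} ∧
    PCA.metastableStates L h = {PCA.allMinus L, PCA.checkerEven L, PCA.checkerOdd L} ∧
    PCA.energy h (PCA.checkerEven L) = PCA.energy h (PCA.checkerOdd L) ∧
    PCA.energy h (PCA.checkerEven L) < PCA.energy h (PCA.allMinus L) ∧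
    0 < PCA.commEnergy L h ∧
    PCA.commEnergy L h = ((PCA.activationEnergy h : ℝ) : EReal) := by
  have h_comm := PCA.commEnergy_eq L_even L_gt h_pos h_lt L_large
  refine ⟨PCA.groundStates_eq L_even h_pos,
    PCA.metastableStates_eq L_even L_gt h_pos h_lt L_large,
    PCA.energy_checkerEven_eq_energy_checkerOdd L_even L_gt h_pos.le h_lt,
    PCA.energy_checkerEven_lt_energy_allMinus L_even L_gt h_pos h_lt, ?_, h_comm⟩
  rw [h_comm]
  exact EReal.coe_pos.2 (PCA.activationEnergy_pos h_pos h_lt)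

theorem mainTheorem3 (L : ℕ) [NeZero L] (h : ℝ) (h_pos : 0 < h) (h_lt : h < 1)
    (L_even : Even L) (L_large : 2 * PCA.critLength h ≤ L) :
    PCA.groundStates L h = {PCA.allPlus L} ∧
    PCA.metastableStates L h = {PCA.allMinus L, PCA.checkerEven L, PCA.checkerOdd L} ∧
    PCA.energy h (PCA.checkerEven L) = PCA.energy h (PCA.checkerOdd L) ∧
    PCA.energy h (PCA.checkerEven L) < PCA.energy h (PCA.allMinus L) ∧
    0 < PCA.commEnergy L h ∧
    PCA.commEnergy L h = ((PCA.activationEnergy h : ℝ) : EReal) := by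
  have h_crit : 1 < PCA.critLength h := PCA.one_lt_critLength h_pos (by linarith)
  exact mainTheorem3_general L h h_pos (by linarith) L_even (by lia) L_large
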